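/- **Setting.** For $d\ge 1$ let $h^*:\mathbb{R}^{2d}\to\{-1,1\}$, $h^*(x)=\operatorname{sign}\big(\sum_{i=1}^{d}x_i^2-\sum_{i=d+1}^{2d}x_i^2\big)$, where $\operatorname{sign}(0)=1$, and let $\mathcal P$ be the set of laws of $(x,h^*(x))$, where the law $P_X$ of $x$ ranges over all Borel probability measures on $\mathbb{R}^{2d}$. A (randomized) learning algorithm $\mathcal A$ maps each finite training sequence $S=(x_i,y_i)_{i=1}^n$ to a probability distribution on functions $h:\mathbb{R}^{2d}\to\{-1,1\}$, and $\mathrm{err}_P(\mathcal A(S))=\Pr[h(x)\ne y]$ over $(x,y)\sim P$ and $h\sim\mathcal A(S)$. It is *orthogonal equivariant* if $\mathcal A((gx_i,y_i)_{i})\circ g$ and $\mathcal A((x_i,y_i)_{i})$ have the same distribution for every orthogonal map $g$ of $\mathbb{R}^{2d}$ and every training sequence. The sample complexity $\mathcal N(\mathcal A,\mathcal P,\varepsilon,\delta)\in\mathbb N\cup\{\infty\}$ is the smallest $n$ such that for every $P\in\mathcal P$, with probability at least $1-\delta$ over $n$ i.i.d. samples $S$ from $P$, $\mathrm{err}_P(\mathcal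 A(S))\le\varepsilon$. A 2-layer convolutional network with filter width $k$, $r$ blocks of length $p$, $rp=D$, and a combined activation and pooling map $\sigma:\mathbb{R}^p\to\mathbb{R}$ has weights $W=(w,a,b)\in\mathbb{R}^k\times\mathbb{R}^r\times\mathbb{R}$ and computes, with indices starting at $0$, $$\mathrm{CNN}[W](x)=\sum_{i=0}^{r-1}a_i\,\sigma\big((w*x)_{pi},\dots,(w*x)_{pi+p-1}\big)+b,\qquad (w*x)_i=\sum_{j=0}^{k-1}w_jx_{(i-j)\bmod D}.$$ Below, $k=1$, $r=2$, $p=d$ and $\sigma(z)=\sum_l z_l^2$. Let $\mathcal F_{\mathrm{CNN}}=\{\operatorname{sign}(\mathrm{CNN}[W]) : W\}$. An algorithm is an $\mathrm{ERM}_{\mathrm{CNN}}$ if for every training sequence it outputs a hypothesis in $\mathcal F_{\mathrm{CNN}}$ with the least number of training mistakes among all of $\mathcal F_{\mathrm{CNN}}$ (ties broken arbitrarily). **Theorem 3.1.** There are universal constants $c,C>0$ such that for all $d\ge1$ the following hold. 1. For every orthogonal equivariant $\mathcal A$, all $0<\varepsilon\le\frac18$ and all $0<\delta\le\frac14$, $$\mathcal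 N(\mathcal A,\mathcal P,\varepsilon,\delta)\ \ge\ c\,\frac{d^2+\ln\frac1\delta}{\varepsilon}.$$ 2. For every $\mathrm{ERM}_{\mathrm{CNN}}$, all $0<\varepsilon\le\frac12$ and all $0<\delta<1$, $$\mathcal N(\mathrm{ERM}_{\mathrm{CNN}},\mathcal P,\varepsilon,\delta)\ \le\ \frac{C}{\varepsilon}\Big(\log\frac1\varepsilon+\log\frac1\delta\Big).$$ 3. $\mathrm{ERM}_{\mathrm{CNN}}$ is realized by gradient descent. Let $\ell:\mathbb{R}\to\mathbb{R}$ be convex, non-increasing and differentiable, with $\ell'$ Lipschitz on every half-line $[M,\infty)$, $\ell(0)\ge1$ and $\lim_{t\to\infty}\ell(t)=0$. Draw all entries of $W^{(0)}$ i.i.d. from $N(0,1)$. With probability one over $W^{(0)}$, for every finite training sequence $S=(x_i,y_i)_{i=1}^n$ with $y_i=h^*(x_i)$ for all $i$, there is $\eta_0>0$ (which may depend on $\ell$, $S$ and $W^{(0)}$) such that for every $\eta\in(0,\eta_0)$ the iterates $W^{(T)}$ of gradient descent on $L(W)=\sum_{i=1}^n\ell(y_i\,\mathrm{CNN}[W](x_i))$,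 with step size $\eta$ for the second layer $(a,b)$ and $0$ for the first layer $w$, satisfy $L(W^{(T)})\to0$, and for all sufficiently large $T$ the hypothesis $\operatorname{sign}(\mathrm{CNN}[W^{(T)}])$ has no training mistakes and is an empirical risk minimizer over $\mathcal F_{\mathrm{CNN}}$ on $S$. -/

import Mathlib

open MeasureTheory ProbabilityTheory Filter Topology
open scoped ENNReal

noncomputable section

namespace ConvSep

/-! ### Learning theory. Labels are the units `{1, -1}` of `ℤ`. -/

/-- The sign of a real number as a label in `{-1, 1}`, with `sign 0 = 1`. -/
def sgn (t : ℝ) : ℤˣ := if 0 ≤ t then 1 else -1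

/-- A sequence of `n` labelled training points. -/
abbrev Dataset (X : Type*) (n : ℕ) : Type _ := Fin n → X × ℤˣ

/-- A (randomized) learning algorithm maps every training sequence, of any length, to a probability
distribution on hypotheses `X → {-1, 1}` (function space carries the product σ-algebra). -/
abbrev LearningAlgorithm (X : Type*) : Type _ :=
  (n : ℕ) → Dataset X n → ProbabilityMeasure (X → ℤˣ)

/-- A deterministic algorithm, seen as a randomized one whose output is a point mass. -/
def deterministic {X : Type*} (A : (n : ℕ) → Dataset X n → (X → ℤˣ)) : LearningAlgorithm X :=
  fun n S => ⟨Measure.dirac (A n S), inferInstance⟩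

/-- `err_P(h) = Pr[h(x) ≠ y]` over `(x, y) ∼ P` and over the random hypothesis `h ∼ μ`. -/
def err {X : Type*} [MeasurableSpace X] (P : Measure (X × ℤˣ))
    (μ : ProbabilityMeasure (X → ℤˣ)) : ℝ≥0∞ :=
  ∫⁻ z, (μ : Measure (X → ℤˣ)) {h | h z.1 ≠ z.2} ∂P

/-- The `(ε, δ)`-sample complexity of `A` on the problem `Prob` (a set of joint distributions): the
smallest `n` such that for each `P ∈ Prob`, except with probability at most `δ` over `n` i.i.d.
samples from `P`, the error of the output is at most `ε`. It is `⊤` if there is no such `n`. -/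
def sampleComplexity {X : Type*} [MeasurableSpace X] (A : LearningAlgorithm X)
    (Prob : Set (Measure (X × ℤˣ))) (ε δ : ℝ) : ℕ∞ :=
  sInf ((fun n : ℕ => (n : ℕ∞)) '' {n : ℕ | ∀ P ∈ Prob,
    Measure.pi (fun _ : Fin n => P) {S : Dataset X n | ENNReal.ofReal ε < err P (A n S)}
      ≤ ENNReal.ofReal δ})

/-- The problem `{all distributions} ⋄ {h}`: the laws of `(x, h x)` where `x` follows an arbitrary
probability measure. -/
def allDistributions {X : Type*} [MeasurableSpace X] (h : X → ℤˣ) : Set (Measure (X × ℤˣ)) :=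
  {P | ∃ PX : Measure X, IsProbabilityMeasure PX ∧ P = PX.map (fun x => (x, h x))}

/-- Equivariance under the orthogonal group: for each data set `(xᵢ, yᵢ)` and each orthogonal `g`,
`A((g xᵢ, yᵢ)ᵢ) ∘ g` and `A((xᵢ, yᵢ)ᵢ)` have the same distribution in function space. -/
def OrthogonalEquivariant {m : ℕ} (A : LearningAlgorithm (EuclideanSpace ℝ (Fin m))) : Prop :=
  ∀ (g : EuclideanSpace ℝ (Fin m) ≃ₗᵢ[ℝ] EuclideanSpace ℝ (Fin m)) (n : ℕ)
    (S : Dataset (EuclideanSpace ℝ (Fin m)) n),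
    (A n (fun i => (g (S i).1, (S i).2)) : Measure (EuclideanSpace ℝ (Fin m) → ℤˣ)).map
        (fun h => h ∘ g)
      = (A n S : Measure (EuclideanSpace ℝ (Fin m) → ℤˣ))

/-- The target `h*(x) = sign (∑_{i ≤ d} xᵢ² - ∑_{i > d} xᵢ²)` on `ℝ^{2d}` (indices start at `0`). -/
def target (d : ℕ) (x : EuclideanSpace ℝ (Fin (2 * d))) : ℤˣ :=
  sgn ((∑ i : Fin (2 * d) with i.val < d, x i ^ 2)
    - ∑ i : Fin (2 * d) with d ≤ i.val, x i ^ 2)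

/-- The number of training mistakes of `h` on `S`. -/
def empiricalErrors {X : Type*} {n : ℕ} (S : Dataset X n) (h : X → ℤˣ) : ℕ :=
  (Finset.univ.filter fun i => h (S i).1 ≠ (S i).2).card

/-- `h` is an empirical risk minimizer over the class `F` for the data set `S`. -/
def IsEmpiricalRiskMinimizer {X : Type*} {n : ℕ} (F : Set (X → ℤˣ)) (S : Dataset X n)
    (h : X → ℤˣ) : Prop :=
  h ∈ F ∧ ∀ h' ∈ F, empiricalErrors S h ≤ empiricalErrors S h'

/-- `A` performs empirical risk minimization over `F` (ties are broken in an arbitrary way). -/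
def IsERM {X : Type*} (F : Set (X → ℤˣ)) (A : (n : ℕ) → Dataset X n → (X → ℤˣ)) : Prop :=
  ∀ (n : ℕ) (S : Dataset X n), IsEmpiricalRiskMinimizer F S (A n S)

/-! ### Two-layer convolutional networks with one channel -/

/-- Circular convolution `[w * x]_i = ∑_j w_j x_{(i - j) mod D}`, all indices starting at `0`
(`(D - 1) * j` is `-j` modulo `D`). -/
def conv {k D : ℕ} (w : Fin k → ℝ) (x : EuclideanSpace ℝ (Fin D)) (i : Fin D) : ℝ :=
  ∑ j : Fin k, w j * x ⟨((i : ℕ) + (D - 1) * (j : ℕ)) % D, Nat.mod_lt _ i.pos⟩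

/-- The weights `(w, a, b) ∈ ℝ^k × ℝ^r × ℝ`. -/
abbrev Weights (k r : ℕ) : Type := (Fin k → ℝ) × (Fin r → ℝ) × ℝ

/-- The 2-layer CNN `x ↦ ∑_{i < r} a_i σ([w * x]_{p i, …, p i + p - 1}) + b` on `ℝ^{r p}`, where
`σ` combines the elementwise non-linearity and the pooling. -/
def cnn {k r p : ℕ} (σ : (Fin p → ℝ) → ℝ) (W : Weights k r)
    (x : EuclideanSpace ℝ (Fin (r * p))) : ℝ :=
  ∑ i : Fin r, W.2.1 i * σ (fun l : Fin p => conv W.1 x (finProdFinEquiv (i, l))) + W.2.2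

/-- Square activation followed by sum pooling. -/
def squarePool {p : ℕ} (z : Fin p → ℝ) : ℝ := ∑ l, z l ^ 2

/-- The hypotheses `sign (CNN[W])`, for all weights `W`. -/
def cnnClass (k r p : ℕ) (σ : (Fin p → ℝ) → ℝ) :
    Set (EuclideanSpace ℝ (Fin (r * p)) → ℤˣ) :=
  {h | ∃ W : Weights k r, h = fun x => sgn (cnn σ W x)}

/-! ### Gradient descent -/

/-- The training loss `L(W) = ∑ᵢ ℓ(yᵢ CNN[W](xᵢ))`. -/
def trainLoss {k r p n : ℕ} (ℓ : ℝ → ℝ) (σ : (Fin p → ℝ) → ℝ)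
    (S : Dataset (EuclideanSpace ℝ (Fin (r * p))) n) (W : Weights k r) : ℝ :=
  ∑ i, ℓ ((((S i).2 : ℤ) : ℝ) * cnn σ W (S i).1)

/-- One step of gradient descent on the training loss with learning rate `η` for the second layer
`(a, b)` and learning rate `0` for the first layer `w`. -/
def gdStep {k r p n : ℕ} (ℓ : ℝ → ℝ) (σ : (Fin p → ℝ) → ℝ)
    (S : Dataset (EuclideanSpace ℝ (Fin (r * p))) n) (η : ℝ) (W : Weights k r) : Weights k r :=
  (W.1,
    fun i => W.2.1 i
      - η * deriv (fun t => trainLoss ℓ σ S (W.1, Function.update W.2.1 i t, W.2.2)) (W.2.1 i),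
    W.2.2 - η * deriv (fun t => trainLoss ℓ σ S (W.1, W.2.1, t)) W.2.2)

/-- Initialization of all weights by i.i.d. standard Gaussians. -/
def gaussianInit (k r : ℕ) : Measure (Weights k r) :=
  (Measure.pi fun _ => gaussianReal 0 1).prod
    ((Measure.pi fun _ => gaussianReal 0 1).prod (gaussianReal 0 1))

/-- Convex non-increasing surrogates `ℓ` of the 0-1 loss: `ℓ(0) ≥ 1`, `ℓ → 0` at `+∞`, and
`ℓ` is differentiable with a derivative that is Lipschitz on every half-line `[M, ∞)`. -/
structure IsSurrogateLoss (ℓ : ℝ → ℝ) : Prop where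
  convex : ConvexOn ℝ Set.univ ℓ
  antitone : Antitone ℓ
  one_le : 1 ≤ ℓ 0
  tendsto_zero : Tendsto ℓ atTop (𝓝 0)
  differentiable : Differentiable ℝ ℓ
  lipschitz_deriv : ∀ M : ℝ, ∃ K : NNReal, LipschitzOnWith K (deriv ℓ) (Set.Ici M)

end ConvSep

end

/-!
An equivariant algorithm cannot distinguish a labelled sample from its image under an orthogonal
map, so it errs on `h*` as it errs on `h* ∘ g` for every orthogonal `g`. The map
`(u, v) ↦ ((u + U v) / √2, (u - U v) / √2)` transforms the quadratic form in `h*` into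
`2 ⟨u, U v⟩`, and `U = exp (t B)` with `B` skew-symmetric and `t > 0` small has entries of any
prescribed signs above the diagonal. Hence the functions `h* ∘ g` shatter the `d (d - 1) / 2` points
`(eᵢ, eⱼ)`, `i < j`, and the algorithm has to learn an arbitrary labelling of them. If they carry
mass `8 ε` in total, and the fixed point `0` of all `g` the rest, a sample must hit a constant
fraction of them. For the confidence term, all shattered points are missed with probability
`(1 - 4 ε) ^ n` when their mass is `4 ε`.

With a filter of width one the networks are half-spaces of `ℝ³` pulled back along
`x ↦ (‖x_{< d}‖², ‖x_{≥ d}‖², 1)`. These have polynomially many traces on a finite sample, so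
symmetrization bounds the error of every hypothesis without training mistakes.

With its first layer frozen the network is linear in `(a, b)`. If `w ≠ 0`, then some `(a, b)`
represents `h*`, and a shift of the bias makes all its margins on the finite training set strictly
positive. Gradient descent therefore minimizes a convex function with infimum `0`, which is smooth
on sublevel sets.
-/

noncomputable section

namespace ConvSep

/-! ### Gradient descent on convex functions -/

section Descent

variable {E : Type*} [NormedAddCommGroup E] [InnerProductSpace ℝ E]
  {f : E → ℝ} {g : E → E} {η : ℝ} {θ₀ : E}

/-- One step of gradient descent with step size `η` along the vector field `g`, which stands for
the gradient of the objective. -/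
def descentStep (η : ℝ) (g : E → E) (θ : E) : E := θ - η • g θ

theorem apply_iterate_descentStep_le (hη : 0 ≤ η)
    (hdesc : ∀ θ, f θ ≤ f θ₀ → f (descentStep η g θ) ≤ f θ - η / 2 * ‖g θ‖ ^ 2) (T : ℕ) :
    f ((descentStep η g)^[T] θ₀) ≤ f θ₀ := by
  induction T with
  | zero => exact le_rfl
  | succ T ih =>
    rw [Function.iterate_succ_apply']
    exact (hdesc _ ih).trans ((sub_le_self _ (by positivity)).trans ih)

theorem antitone_iterate_descentStep (hη : 0 ≤ η)
    (hdesc : ∀ θ, f θ ≤ f θ₀ → f (descentStep η g θ) ≤ f θ - η / 2 * ‖g θ‖ ^ 2) :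
    Antitone fun T : ℕ => f ((descentStep η g)^[T] θ₀) := by
  refine antitone_nat_of_succ_le fun T => ?_
  rw [Function.iterate_succ_apply']
  exact (hdesc _ (apply_iterate_descentStep_le hη hdesc T)).trans
    (sub_le_self _ (by positivity))

theorem norm_sq_descentStep_sub_le {θ u : E} (hη : 0 ≤ η)
    (hsub : f θ - f u ≤ inner ℝ (g θ) (θ - u))
    (hdesc : f (descentStep η g θ) ≤ f θ - η / 2 * ‖g θ‖ ^ 2) :
    ‖descentStep η g θ - u‖ ^ 2 ≤ ‖θ - u‖ ^ 2 - 2 * η * (f (descentStep η g θ) - f u) := by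
  have hexpand : ‖descentStep η g θ - u‖ ^ 2
      = ‖θ - u‖ ^ 2 - 2 * η * inner ℝ (g θ) (θ - u) + η ^ 2 * ‖g θ‖ ^ 2 := by
    rw [descentStep, sub_right_comm, norm_sub_sq_real, real_inner_smul_right, norm_smul,
      real_inner_comm, mul_pow, Real.norm_eq_abs, sq_abs]
    ring
  have hsub' := mul_le_mul_of_nonneg_left hsub hη
  have hdesc' := mul_le_mul_of_nonneg_left hdesc hη
  linarith

theorem mul_apply_iterate_descentStep_sub_le (hη : 0 ≤ η)
    (hsub : ∀ θ u, f θ - f u ≤ inner ℝ (g θ) (θ - u))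
    (hdesc : ∀ θ, f θ ≤ f θ₀ → f (descentStep η g θ) ≤ f θ - η / 2 * ‖g θ‖ ^ 2) (u : E) (T : ℕ) :
    2 * η * (T * (f ((descentStep η g)^[T] θ₀) - f u)) ≤ ‖θ₀ - u‖ ^ 2 := by
  set θ : ℕ → E := fun T => (descentStep η g)^[T] θ₀
  suffices h : ‖θ T - u‖ ^ 2 + 2 * η * (T * (f (θ T) - f u)) ≤ ‖θ₀ - u‖ ^ 2 from
    (le_add_of_nonneg_left (sq_nonneg _)).trans h
  induction T with
  | zero => simp [θ]
  | succ T ih =>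
    have hstep : ‖θ (T + 1) - u‖ ^ 2 ≤ ‖θ T - u‖ ^ 2 - 2 * η * (f (θ (T + 1)) - f u) := by
      simp only [θ, Function.iterate_succ_apply']
      exact norm_sq_descentStep_sub_le hη (hsub _ _)
        (hdesc _ (apply_iterate_descentStep_le hη hdesc T))
    have hanti : 2 * η * (T * f (θ (T + 1))) ≤ 2 * η * (T * f (θ T)) := by
      gcongr
      exact antitone_iterate_descentStep hη hdesc T.le_succ
    push_cast
    linarith

theorem tendsto_apply_iterate_descentStep {m : ℝ} (hη : 0 < η)
    (hsub : ∀ θ u, f θ - f u ≤ inner ℝ (g θ) (θ - u))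
    (hdesc : ∀ θ, f θ ≤ f θ₀ → f (descentStep η g θ) ≤ f θ - η / 2 * ‖g θ‖ ^ 2)
    (hm : IsGLB (Set.range f) m) :
    Tendsto (fun T : ℕ => f ((descentStep η g)^[T] θ₀)) atTop (𝓝 m) := by
  refine tendsto_order.2 ⟨fun r hr => .of_forall fun T => hr.trans_le (hm.1 ⟨_, rfl⟩),
    fun r hr => ?_⟩
  obtain ⟨_, ⟨u, rfl⟩, -, hu⟩ := hm.exists_between hr
  have hrate : Tendsto (fun T : ℕ => f u + ‖θ₀ - u‖ ^ 2 / (2 * η) / T) atTop (𝓝 (f u)) := by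
    simpa using (tendsto_const_div_atTop_nhds_zero_nat (‖θ₀ - u‖ ^ 2 / (2 * η))).const_add (f u)
  filter_upwards [hrate.eventually_lt_const hu, eventually_gt_atTop 0] with T hT hT0
  refine lt_of_le_of_lt ?_ hT
  have hbound := mul_apply_iterate_descentStep_sub_le hη.le hsub hdesc u T
  rw [← sub_le_iff_le_add', le_div_iff₀ (Nat.cast_pos.2 hT0), le_div_iff₀ (by positivity)]
  linarith

end Descent

theorem add_deriv_mul_sub_le_of_convexOn {s : Set ℝ} {f : ℝ → ℝ} (hf : ConvexOn ℝ s f) {x y : ℝ}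
    (hx : x ∈ s) (hy : y ∈ s) (hfx : DifferentiableAt ℝ f x) :
    f x + deriv f x * (y - x) ≤ f y := by
  rcases lt_trichotomy x y with h | rfl | h
  · have hslope := hf.deriv_le_slope hx hy h hfx
    rw [slope_def_field, le_div_iff₀ (sub_pos.2 h)] at hslope
    linarith
  · simp
  · have hslope := hf.slope_le_deriv hy hx h hfx
    rw [slope_def_field, div_le_iff₀ (sub_pos.2 h)] at hslope
    linarith

theorem le_add_deriv_mul_sub_add_of_lipschitzOnWith {s : Set ℝ} {f : ℝ → ℝ}
    (hf : ConvexOn ℝ s f) {K : NNReal} (hK : LipschitzOnWith K (deriv f) s) {x y : ℝ}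
    (hx : x ∈ s) (hy : y ∈ s) (hfy : DifferentiableAt ℝ f y) :
    f y ≤ f x + deriv f x * (y - x) + K * (y - x) ^ 2 := by
  have htangent := add_deriv_mul_sub_le_of_convexOn hf hy hx hfy
  have hlip : (deriv f y - deriv f x) * (y - x) ≤ K * (y - x) ^ 2 :=
    calc (deriv f y - deriv f x) * (y - x)
      _ ≤ |deriv f y - deriv f x| * |y - x| := (le_abs_self _).trans_eq (abs_mul _ _)
      _ ≤ K * |y - x| * |y - x| := by gcongr; exact hK.dist_le_mul y hy x hx
      _ = K * (y - x) ^ 2 := by rw [mul_assoc, ← sq, sq_abs]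
  linarith

/-! ### Convex losses of linear margins -/

section MarginRisk

variable {E ι : Type*} [NormedAddCommGroup E] [InnerProductSpace ℝ E] [Fintype ι] {ℓ : ℝ → ℝ}

/-- The total loss `∑ᵢ ℓ(⟨ψᵢ, θ⟩)` of the linear predictor `θ`, where `ψᵢ` is the feature vector of
the `i`-th training point multiplied by its label. -/
def marginRisk (ℓ : ℝ → ℝ) (ψ : ι → E) (θ : E) : ℝ := ∑ i, ℓ (inner ℝ (ψ i) θ)

/-- The gradient of `marginRisk`. -/
def marginGrad (ℓ : ℝ → ℝ) (ψ : ι → E) (θ : E) : E := ∑ i, deriv ℓ (inner ℝ (ψ i) θ) • ψ i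

theorem inner_marginGrad (ψ : ι → E) (θ v : E) :
    inner ℝ (marginGrad ℓ ψ θ) v = ∑ i, deriv ℓ (inner ℝ (ψ i) θ) * inner ℝ (ψ i) v := by
  simp only [marginGrad, sum_inner, real_inner_smul_left]

theorem hasGradientAt_marginRisk [CompleteSpace E] (hdiff : Differentiable ℝ ℓ) (ψ : ι → E)
    (θ : E) : HasGradientAt (marginRisk ℓ ψ) (marginGrad ℓ ψ θ) θ := by
  have hsum : HasFDerivAt (marginRisk ℓ ψ)
      (∑ i, deriv ℓ (inner ℝ (ψ i) θ) • innerSL ℝ (ψ i)) θ :=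
    HasFDerivAt.fun_sum fun i _ =>
      (hdiff (inner ℝ (ψ i) θ)).hasDerivAt.comp_hasFDerivAt θ (innerSL ℝ (ψ i)).hasFDerivAt
  refine hasGradientAt_iff_hasFDerivAt.2 (hsum.congr_fderiv ?_)
  ext v
  simp [inner_marginGrad]

theorem le_marginRisk (hℓ : ∀ t, 0 ≤ ℓ t) (ψ : ι → E) (θ : E) (i : ι) :
    ℓ (inner ℝ (ψ i) θ) ≤ marginRisk ℓ ψ θ :=
  Finset.single_le_sum (f := fun i => ℓ (inner ℝ (ψ i) θ)) (fun _ _ => hℓ _) (Finset.mem_univ i)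

theorem marginRisk_sub_le_inner (hconv : ConvexOn ℝ Set.univ ℓ) (hdiff : Differentiable ℝ ℓ)
    (ψ : ι → E) (θ u : E) :
    marginRisk ℓ ψ θ - marginRisk ℓ ψ u ≤ inner ℝ (marginGrad ℓ ψ θ) (θ - u) := by
  rw [inner_marginGrad, marginRisk, marginRisk, ← Finset.sum_sub_distrib]
  refine Finset.sum_le_sum fun i _ => ?_
  have htangent := add_deriv_mul_sub_le_of_convexOn hconv (Set.mem_univ (inner ℝ (ψ i) θ))
    (Set.mem_univ (inner ℝ (ψ i) u)) (hdiff _)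
  rw [inner_sub_right]
  linarith

theorem marginRisk_add_le {M : ℝ} {K : NNReal} (hconv : ConvexOn ℝ (Set.Ici M) ℓ)
    (hdiff : Differentiable ℝ ℓ) (hK : LipschitzOnWith K (deriv ℓ) (Set.Ici M)) {ψ : ι → E}
    {θ v : E} (hθ : ∀ i, M ≤ inner ℝ (ψ i) θ) (hθv : ∀ i, M ≤ inner ℝ (ψ i) (θ + v)) :
    marginRisk ℓ ψ (θ + v)
      ≤ marginRisk ℓ ψ θ + inner ℝ (marginGrad ℓ ψ θ) v + K * (∑ i, ‖ψ i‖ ^ 2) * ‖v‖ ^ 2 := by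
  rw [inner_marginGrad, marginRisk, marginRisk, Finset.mul_sum, Finset.sum_mul,
    ← Finset.sum_add_distrib, ← Finset.sum_add_distrib]
  refine Finset.sum_le_sum fun i _ => ?_
  have hsmooth := le_add_deriv_mul_sub_add_of_lipschitzOnWith hconv hK (hθ i) (hθv i) (hdiff _)
  rw [inner_add_right, add_sub_cancel_left] at hsmooth
  have hcs : inner ℝ (ψ i) v ^ 2 ≤ ‖ψ i‖ ^ 2 * ‖v‖ ^ 2 := by
    rw [← mul_pow, ← sq_abs]
    gcongr
    exact abs_real_inner_le_norm _ _
  calc ℓ (inner ℝ (ψ i) (θ + v))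
    _ ≤ ℓ (inner ℝ (ψ i) θ) + deriv ℓ (inner ℝ (ψ i) θ) * inner ℝ (ψ i) v
          + K * inner ℝ (ψ i) v ^ 2 := by rwa [inner_add_right]
    _ ≤ _ := by rw [mul_assoc]; gcongr

theorem norm_marginGrad_le {M : ℝ} (hanti : Antitone ℓ) (hmono : Monotone (deriv ℓ)) {ψ : ι → E}
    {θ : E} (hθ : ∀ i, M ≤ inner ℝ (ψ i) θ) :
    ‖marginGrad ℓ ψ θ‖ ≤ -deriv ℓ M * ∑ i, ‖ψ i‖ := by
  rw [marginGrad, Finset.mul_sum]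
  refine norm_sum_le_of_le _ fun i _ => ?_
  rw [norm_smul, Real.norm_eq_abs, abs_of_nonpos hanti.deriv_nonpos]
  gcongr
  exact hmono (hθ i)

namespace IsSurrogateLoss

theorem nonneg (hℓ : IsSurrogateLoss ℓ) (t : ℝ) : 0 ≤ ℓ t :=
  hℓ.antitone.le_of_tendsto hℓ.tendsto_zero t

theorem monotone_deriv (hℓ : IsSurrogateLoss ℓ) : Monotone (deriv ℓ) := fun s t hst =>
  hℓ.convex.monotoneOn_deriv (fun x _ => hℓ.differentiable x) (Set.mem_univ s) (Set.mem_univ t) hst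

theorem exists_forall_le_of_apply_le (hℓ : IsSurrogateLoss ℓ) (B : ℝ) :
    ∃ M : ℝ, ∀ t, ℓ t ≤ B → M ≤ t := by
  have htangent : ∀ t, ℓ 0 + deriv ℓ 0 * t ≤ ℓ t := fun t => by
    simpa using add_deriv_mul_sub_le_of_convexOn hℓ.convex (Set.mem_univ 0) (Set.mem_univ t)
      (hℓ.differentiable 0)
  have hneg : deriv ℓ 0 < 0 := by
    refine hℓ.antitone.deriv_nonpos.lt_of_ne fun h0 => ?_
    obtain ⟨t, ht⟩ := (hℓ.tendsto_zero.eventually_lt_const one_pos).exists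
    have := htangent t
    rw [h0] at this
    linarith [hℓ.one_le]
  refine ⟨B / deriv ℓ 0, fun t ht => ?_⟩
  rw [div_le_iff_of_neg hneg]
  linarith [hℓ.one_le, htangent t]

/- On a sublevel set all margins are at least some `M`, so the gradient is bounded there and a step
that is short enough keeps all margins above `M - 1`, where `ℓ'` is Lipschitz. -/
theorem exists_marginRisk_descentStep_le (hℓ : IsSurrogateLoss ℓ) (ψ : ι → E) (B : ℝ) :
    ∃ η₀ : ℝ, 0 < η₀ ∧ ∀ η, 0 < η → η < η₀ → ∀ θ, marginRisk ℓ ψ θ ≤ B →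
      marginRisk ℓ ψ (descentStep η (marginGrad ℓ ψ) θ)
        ≤ marginRisk ℓ ψ θ - η / 2 * ‖marginGrad ℓ ψ θ‖ ^ 2 := by
  obtain ⟨M, hM⟩ := hℓ.exists_forall_le_of_apply_le B
  obtain ⟨K, hK⟩ := hℓ.lipschitz_deriv (M - 1)
  set R : ℝ := ∑ i, ‖ψ i‖
  set Q : ℝ := ∑ i, ‖ψ i‖ ^ 2
  set G : ℝ := -deriv ℓ M * R
  have hR : 0 ≤ R := Finset.sum_nonneg fun i _ => norm_nonneg _
  have hQ : 0 ≤ K * Q := mul_nonneg K.2 (Finset.sum_nonneg fun i _ => sq_nonneg _)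
  have hG : 0 ≤ G := mul_nonneg (neg_nonneg.2 hℓ.antitone.deriv_nonpos) hR
  have hden : 0 < R * G + 2 * (K * Q) + 1 := by linarith [mul_nonneg hR hG]
  refine ⟨1 / (R * G + 2 * (K * Q) + 1), one_div_pos.2 hden, fun η hη hη₀ θ hθ => ?_⟩
  rw [lt_div_iff₀ hden] at hη₀
  have hηRG : 0 ≤ η * (R * G) := mul_nonneg hη.le (mul_nonneg hR hG)
  have hηQ : 0 ≤ η * (K * Q) := mul_nonneg hη.le hQ
  have hmargin : ∀ i, M ≤ inner ℝ (ψ i) θ := fun i =>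
    hM _ ((le_marginRisk hℓ.nonneg ψ θ i).trans hθ)
  set g := marginGrad ℓ ψ θ
  have hnew : ∀ i, M - 1 ≤ inner ℝ (ψ i) (θ + -(η • g)) := fun i => by
    have hψ : ‖ψ i‖ ≤ R :=
      Finset.single_le_sum (f := fun i => ‖ψ i‖) (fun _ _ => norm_nonneg _) (Finset.mem_univ i)
    have hψg : inner ℝ (ψ i) g ≤ R * G := (real_inner_le_norm _ _).trans
      (mul_le_mul hψ (norm_marginGrad_le hℓ.antitone hℓ.monotone_deriv hmargin)
        (norm_nonneg _) hR)
    have hηψg : η * inner ℝ (ψ i) g ≤ η * (R * G) := by gcongr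
    rw [inner_add_right, inner_neg_right, real_inner_smul_right]
    linarith [hmargin i]
  have hquad := marginRisk_add_le (hℓ.convex.subset (Set.subset_univ _) (convex_Ici _))
    hℓ.differentiable hK (fun i => (sub_le_self M zero_le_one).trans (hmargin i)) hnew
  rw [inner_neg_right, real_inner_smul_right, real_inner_self_eq_norm_sq, norm_neg, norm_smul,
    Real.norm_of_nonneg hη.le, ← sub_eq_add_neg] at hquad
  have hsmall : η * ‖g‖ ^ 2 * (η * (K * Q)) ≤ η * ‖g‖ ^ 2 * (1 / 2) := by
    gcongr
    linarith
  rw [descentStep]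
  linarith

theorem isGLB_range_marginRisk (hℓ : IsSurrogateLoss ℓ) (ψ : ι → E)
    (hsep : ∃ u, ∀ i, 0 < inner ℝ (ψ i) u) : IsGLB (Set.range (marginRisk ℓ ψ)) 0 := by
  obtain ⟨u, hu⟩ := hsep
  have hray : Tendsto (fun s : ℝ => marginRisk ℓ ψ (s • u)) atTop (𝓝 (∑ _i : ι, (0 : ℝ))) := by
    refine tendsto_finsetSum _ fun i _ => hℓ.tendsto_zero.comp ?_
    simp only [real_inner_smul_right]
    exact tendsto_id.atTop_mul_const (hu i)
  rw [Finset.sum_const_zero] at hray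
  refine ⟨?_, fun b hb => ge_of_tendsto' hray fun s => hb ⟨_, rfl⟩⟩
  rintro _ ⟨θ, rfl⟩
  exact Finset.sum_nonneg fun i _ => hℓ.nonneg _

theorem exists_tendsto_marginRisk_iterate (hℓ : IsSurrogateLoss ℓ) (ψ : ι → E)
    (hsep : ∃ u, ∀ i, 0 < inner ℝ (ψ i) u) (θ₀ : E) :
    ∃ η₀ : ℝ, 0 < η₀ ∧ ∀ η, 0 < η → η < η₀ →
      Tendsto (fun T : ℕ => marginRisk ℓ ψ ((descentStep η (marginGrad ℓ ψ))^[T] θ₀))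
        atTop (𝓝 0) := by
  obtain ⟨η₀, hη₀, hdesc⟩ := hℓ.exists_marginRisk_descentStep_le ψ (marginRisk ℓ ψ θ₀)
  exact ⟨η₀, hη₀, fun η hη hlt => tendsto_apply_iterate_descentStep hη
    (marginRisk_sub_le_inner hℓ.convex hℓ.differentiable ψ) (hdesc η hη hlt)
    (hℓ.isGLB_range_marginRisk ψ hsep)⟩

end IsSurrogateLoss

end MarginRisk

/-! ### Gradient descent on the second layer of a network -/

theorem sgn_eq_of_mul_pos {t : ℝ} {y : ℤˣ} (h : 0 < ((y : ℤ) : ℝ) * t) : sgn t = y := by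
  rcases Int.units_eq_one_or y with rfl | rfl
  · rw [sgn, if_pos (by simpa using h.le)]
  · rw [sgn, if_neg (by simpa using h)]

theorem sgn_mul_of_pos {c : ℝ} (hc : 0 < c) (t : ℝ) : sgn (c * t) = sgn t := by
  simp only [sgn, mul_nonneg_iff_of_pos_left hc]

theorem exists_forall_sgn_mul_add_pos {ι : Type*} [Finite ι] (m : ι → ℝ) :
    ∃ b : ℝ, ∀ i, 0 < ((sgn (m i) : ℤ) : ℝ) * (m i + b) := by
  have hsmall : ∀ᶠ b in 𝓝[>] (0 : ℝ), ∀ i, 0 < ((sgn (m i) : ℤ) : ℝ) * (m i + b) := by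
    refine eventually_all.2 fun i => ?_
    rcases le_or_gt 0 (m i) with hi | hi
    · filter_upwards [eventually_mem_nhdsWithin] with b hb
      simpa [sgn, hi] using add_pos_of_nonneg_of_pos hi hb
    · filter_upwards [nhdsWithin_le_nhds (eventually_lt_nhds (neg_pos.2 hi))] with b hb
      rw [sgn, if_neg hi.not_ge]
      push_cast
      linarith
  exact hsmall.exists

theorem isEmpiricalRiskMinimizer_of_forall_eq {X : Type*} {n : ℕ} {F : Set (X → ℤˣ)}
    {S : Dataset X n} {h : X → ℤˣ} (hF : h ∈ F) (hS : ∀ i, h (S i).1 = (S i).2) :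
    IsEmpiricalRiskMinimizer F S h := by
  have hzero : empiricalErrors S h = 0 := by simp [empiricalErrors, hS]
  exact ⟨hF, fun h' _ => hzero ▸ Nat.zero_le _⟩

theorem hasDerivAt_toLp_update {ι : Type*} [Fintype ι] [DecidableEq ι] (θ : ι → ℝ) (j : ι) (t : ℝ) :
    HasDerivAt (fun s => WithLp.toLp 2 (Function.update θ j s)) (EuclideanSpace.single j (1 : ℝ))
      t :=
  ((EuclideanSpace.equiv ι ℝ).symm.toContinuousLinearMap.hasFDerivAt).comp_hasDerivAt t
    (hasDerivAt_update θ j t)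

section SecondLayer

variable {k r p n : ℕ} {σ : (Fin p → ℝ) → ℝ} {ℓ : ℝ → ℝ}

/-- The input of the second layer of a network with first-layer weights `w`, together with a
constant coordinate `none`, which multiplies the bias. -/
def feature (σ : (Fin p → ℝ) → ℝ) (w : Fin k → ℝ) (x : EuclideanSpace ℝ (Fin (r * p))) :
    EuclideanSpace ℝ (Option (Fin r)) :=
  WithLp.toLp 2 fun o => o.elim 1 fun i => σ fun l => conv w x (finProdFinEquiv (i, l))

/-- The second-layer weights `(a, b)` as one vector; the coordinate `none` is the bias. -/
def secondLayer (v : (Fin r → ℝ) × ℝ) : EuclideanSpace ℝ (Option (Fin r)) :=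
  WithLp.toLp 2 fun o => o.elim v.2 v.1

/-- The input of the second layer multiplied by the label, so that a network has a positive margin
on the `i`-th training point if and only if its second layer has positive inner product with this
vector. -/
def signedFeature (σ : (Fin p → ℝ) → ℝ) (w : Fin k → ℝ)
    (S : Dataset (EuclideanSpace ℝ (Fin (r * p))) n) (i : Fin n) :
    EuclideanSpace ℝ (Option (Fin r)) :=
  (((S i).2 : ℤ) : ℝ) • feature σ w (S i).1

theorem inner_feature_secondLayer (w : Fin k → ℝ) (v : (Fin r → ℝ) × ℝ)
    (x : EuclideanSpace ℝ (Fin (r * p))) :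
    inner ℝ (feature σ w x) (secondLayer v) = cnn σ (w, v) x := by
  simp [feature, secondLayer, cnn, PiLp.inner_apply, Fintype.sum_option, add_comm]

theorem inner_signedFeature_secondLayer (w : Fin k → ℝ) (v : (Fin r → ℝ) × ℝ)
    (S : Dataset (EuclideanSpace ℝ (Fin (r * p))) n) (i : Fin n) :
    inner ℝ (signedFeature σ w S i) (secondLayer v)
      = (((S i).2 : ℤ) : ℝ) * cnn σ (w, v) (S i).1 := by
  rw [signedFeature, real_inner_smul_left, inner_feature_secondLayer]

theorem trainLoss_eq_marginRisk (S : Dataset (EuclideanSpace ℝ (Fin (r * p))) n)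
    (W : Weights k r) :
    trainLoss ℓ σ S W = marginRisk ℓ (signedFeature σ W.1 S) (secondLayer W.2) := by
  simp only [trainLoss, marginRisk, inner_signedFeature_secondLayer]

theorem deriv_trainLoss_of_secondLayer_eq (hℓ : Differentiable ℝ ℓ)
    (S : Dataset (EuclideanSpace ℝ (Fin (r * p))) n) (W : Weights k r) {o : Option (Fin r)}
    {v : ℝ → (Fin r → ℝ) × ℝ}
    (hv : ∀ t, secondLayer (v t) = WithLp.toLp 2 (Function.update (secondLayer W.2).ofLp o t)) :
    deriv (fun t => trainLoss ℓ σ S (W.1, v t)) (secondLayer W.2 o)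
      = marginGrad ℓ (signedFeature σ W.1 S) (secondLayer W.2) o := by
  simp only [trainLoss_eq_marginRisk, hv]
  have hgrad := (hasGradientAt_marginRisk hℓ (signedFeature σ W.1 S)
    (secondLayer W.2)).hasFDerivAt
  have hcomp := HasFDerivAt.comp_hasDerivAt_of_eq (secondLayer W.2 o) hgrad
    (hasDerivAt_toLp_update (secondLayer W.2).ofLp o (secondLayer W.2 o)) (by simp)
  rw [← Function.comp_def, hcomp.deriv]
  simp [EuclideanSpace.inner_single_right]

theorem secondLayer_gdStep (hℓ : Differentiable ℝ ℓ)
    (S : Dataset (EuclideanSpace ℝ (Fin (r * p))) n) (η : ℝ) (W : Weights k r) :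
    secondLayer (gdStep ℓ σ S η W).2
      = descentStep η (marginGrad ℓ (signedFeature σ W.1 S)) (secondLayer W.2) := by
  ext o
  rw [descentStep, PiLp.sub_apply, PiLp.smul_apply, smul_eq_mul]
  cases o with
  | none =>
    rw [← deriv_trainLoss_of_secondLayer_eq hℓ S W (v := fun t => (W.2.1, t))
      fun t => PiLp.ext fun o => by cases o <;> simp [secondLayer]]
    rfl
  | some i =>
    rw [← deriv_trainLoss_of_secondLayer_eq hℓ S W
      (v := fun t => (Function.update W.2.1 i t, W.2.2))
      fun t => PiLp.ext fun o => by cases o <;> simp [secondLayer, Function.update_apply]]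
    rfl

theorem iterate_gdStep_fst (S : Dataset (EuclideanSpace ℝ (Fin (r * p))) n) (η : ℝ)
    (W : Weights k r) (T : ℕ) : ((gdStep ℓ σ S η)^[T] W).1 = W.1 := by
  induction T with
  | zero => rfl
  | succ T ih => rwa [Function.iterate_succ_apply']

theorem secondLayer_iterate_gdStep (hℓ : Differentiable ℝ ℓ)
    (S : Dataset (EuclideanSpace ℝ (Fin (r * p))) n) (η : ℝ) (W : Weights k r) (T : ℕ) :
    secondLayer ((gdStep ℓ σ S η)^[T] W).2
      = (descentStep η (marginGrad ℓ (signedFeature σ W.1 S)))^[T] (secondLayer W.2) := by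
  induction T with
  | zero => rfl
  | succ T ih =>
    rw [Function.iterate_succ_apply', Function.iterate_succ_apply', secondLayer_gdStep hℓ, ih,
      iterate_gdStep_fst]

theorem sgn_cnn_eq_of_trainLoss_lt_one (hℓ : IsSurrogateLoss ℓ)
    {S : Dataset (EuclideanSpace ℝ (Fin (r * p))) n} {W : Weights k r}
    (hW : trainLoss ℓ σ S W < 1) (i : Fin n) : sgn (cnn σ W (S i).1) = (S i).2 := by
  refine sgn_eq_of_mul_pos (lt_of_not_ge fun hneg => ?_)
  have hterm := le_marginRisk hℓ.nonneg (signedFeature σ W.1 S) (secondLayer W.2) i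
  rw [← trainLoss_eq_marginRisk, inner_signedFeature_secondLayer] at hterm
  linarith [hℓ.antitone hneg, hℓ.one_le]

theorem exists_forall_gdStep_isEmpiricalRiskMinimizer (hℓ : IsSurrogateLoss ℓ)
    (S : Dataset (EuclideanSpace ℝ (Fin (r * p))) n) {W₀ : Weights k r}
    (hreal : ∃ v, ∀ i, (S i).2 = sgn (cnn σ (W₀.1, v) (S i).1)) :
    ∃ η₀ : ℝ, 0 < η₀ ∧ ∀ η : ℝ, 0 < η → η < η₀ →
      Tendsto (fun T : ℕ => trainLoss ℓ σ S ((gdStep ℓ σ S η)^[T] W₀)) atTop (𝓝 0) ∧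
      ∀ᶠ T : ℕ in atTop,
        (∀ i, sgn (cnn σ ((gdStep ℓ σ S η)^[T] W₀) (S i).1) = (S i).2) ∧
        IsEmpiricalRiskMinimizer (cnnClass k r p σ) S
          (fun x => sgn (cnn σ ((gdStep ℓ σ S η)^[T] W₀) x)) := by
  obtain ⟨v, hv⟩ := hreal
  obtain ⟨b, hb⟩ := exists_forall_sgn_mul_add_pos fun i => cnn σ (W₀.1, v) (S i).1
  have hsep : ∃ u, ∀ i, 0 < inner ℝ (signedFeature σ W₀.1 S i) u := by
    refine ⟨secondLayer (v.1, v.2 + b), fun i => ?_⟩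
    rw [inner_signedFeature_secondLayer, hv]
    simpa only [cnn, add_assoc] using hb i
  obtain ⟨η₀, hη₀, hdescent⟩ := hℓ.exists_tendsto_marginRisk_iterate _ hsep (secondLayer W₀.2)
  refine ⟨η₀, hη₀, fun η hη hlt => ?_⟩
  have hlim : Tendsto (fun T : ℕ => trainLoss ℓ σ S ((gdStep ℓ σ S η)^[T] W₀)) atTop (𝓝 0) := by
    simpa only [trainLoss_eq_marginRisk, iterate_gdStep_fst,
      secondLayer_iterate_gdStep hℓ.differentiable] using hdescent η hη hlt
  refine ⟨hlim, ?_⟩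
  filter_upwards [hlim.eventually_lt_const one_pos] with T hT
  have hfit := sgn_cnn_eq_of_trainLoss_lt_one hℓ hT
  exact ⟨hfit, isEmpiricalRiskMinimizer_of_forall_eq ⟨_, rfl⟩ hfit⟩

end SecondLayer

/-! ### The network with one filter of width one -/

section SquareNetwork

variable {r p : ℕ}

/-- The squared norm of the `i`-th block of `x`. -/
def blockSq (x : EuclideanSpace ℝ (Fin (r * p))) (i : Fin r) : ℝ :=
  ∑ l : Fin p, x (finProdFinEquiv (i, l)) ^ 2

theorem squarePool_conv (w : Fin 1 → ℝ) (x : EuclideanSpace ℝ (Fin (r * p))) (i : Fin r) :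
    squarePool (fun l => conv w x (finProdFinEquiv (i, l))) = w 0 ^ 2 * blockSq x i := by
  have hconv : ∀ j : Fin (r * p), conv w x j = w 0 * x j := fun j => by
    simp [conv, Nat.mod_eq_of_lt j.isLt]
  simp only [squarePool, hconv, mul_pow, ← Finset.mul_sum, blockSq]

theorem cnn_squarePool (W : Weights 1 r) (x : EuclideanSpace ℝ (Fin (r * p))) :
    cnn squarePool W x = ∑ i, W.2.1 i * (W.1 0 ^ 2 * blockSq x i) + W.2.2 := by
  simp only [cnn, squarePool_conv]

variable {d : ℕ}

theorem target_eq_sgn_blockSq (x : EuclideanSpace ℝ (Fin (2 * d))) :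
    target d x = sgn (blockSq x 0 - blockSq x 1) := by
  simp only [target, blockSq, Finset.sum_filter]
  rw [← finProdFinEquiv.sum_comp, ← finProdFinEquiv.sum_comp, Fintype.sum_prod_type,
    Fintype.sum_prod_type]
  simp [Fin.sum_univ_two, not_le_of_gt]

theorem target_eq_sgn_cnn {w : Fin 1 → ℝ} (hw : w 0 ≠ 0) (x : EuclideanSpace ℝ (Fin (2 * d))) :
    target d x = sgn (cnn squarePool (w, ![1, -1], 0) x) := by
  rw [target_eq_sgn_blockSq, ← sgn_mul_of_pos (sq_pos_of_ne_zero hw), mul_sub, cnn_squarePool]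
  simp [Fin.sum_univ_two, sub_eq_add_neg]

theorem target_mem_cnnClass : target d ∈ cnnClass 1 2 d squarePool :=
  ⟨(1, ![1, -1], 0), funext (target_eq_sgn_cnn one_ne_zero)⟩

theorem ae_gaussianInit_fst_ne_zero (k r : ℕ) (j : Fin k) :
    ∀ᵐ W ∂(gaussianInit k r), W.1 j ≠ 0 := by
  have := nullSingletonClass_gaussianReal (μ := 0) (v := 1) one_ne_zero
  have hreal : ∀ᵐ t ∂(gaussianReal 0 1), t ≠ 0 := by simp [ae_iff]
  have hfilter : ∀ᵐ w ∂(Measure.pi fun _ : Fin k => gaussianReal 0 1), w j ≠ 0 :=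
    (measurePreserving_eval (fun _ : Fin k => gaussianReal 0 1) j).quasiMeasurePreserving.ae hreal
  exact Measure.quasiMeasurePreserving_fst.ae hfilter

end SquareNetwork

/-! ### Uniform convergence for consistent hypotheses -/

section GhostSample

variable {ι κ Z : Type*}

/-- The weight of a training point and a ghost point with respect to an error set `D`: training
errors are excluded and ghost errors count twice. -/
def ghostWeight (D : Set Z) (q : Z × Z) : ℝ≥0∞ :=
  Dᶜ.indicator 1 q.1 * (1 + D.indicator 1 q.2)

theorem ghostWeight_congr {D E : Set Z} {q : Z × Z} (hfst : q.1 ∈ D ↔ q.1 ∈ E)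
    (hsnd : q.2 ∈ D ↔ q.2 ∈ E) : ghostWeight D q = ghostWeight E q := by
  classical
  simp only [ghostWeight, Set.indicator_apply, Set.mem_compl_iff, hfst, hsnd]

theorem ghostWeight_add_swap_le (D : Set Z) (q : Z × Z) :
    ghostWeight D q + ghostWeight D q.swap ≤ 2 := by
  obtain ⟨x, y⟩ := q
  by_cases hx : x ∈ D <;> by_cases hy : y ∈ D <;>
    simp [ghostWeight, hx, hy, one_add_one_eq_two]

/-- The pairs `z` with the two entries interchanged at the positions marked by `s`; this is the
symmetrization of a training sample and a ghost sample. -/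
def swapAt (s : ι → Bool) (z : ι → Z × Z) (i : ι) : Z × Z :=
  bif s i then (z i).swap else z i

/-- The training sample followed by the ghost sample. -/
def doubleSample (z : ι → Z × Z) : ι ⊕ ι → Z :=
  Sum.elim (fun i => (z i).1) fun i => (z i).2

theorem ghostWeight_swapAt_congr {D E : Set Z} {z : ι → Z × Z}
    (h : doubleSample z ⁻¹' D = doubleSample z ⁻¹' E) (s : ι → Bool) (i : ι) :
    ghostWeight D (swapAt s z i) = ghostWeight E (swapAt s z i) := by
  have hfst : (z i).1 ∈ D ↔ (z i).1 ∈ E := Set.ext_iff.1 h (.inl i)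
  have hsnd : (z i).2 ∈ D ↔ (z i).2 ∈ E := Set.ext_iff.1 h (.inr i)
  unfold swapAt
  cases s i
  · exact ghostWeight_congr hfst hsnd
  · exact ghostWeight_congr hsnd hfst

variable [Fintype ι]

theorem sum_prod_ghostWeight_swapAt_le [DecidableEq ι] (D : Set Z) (z : ι → Z × Z) :
    ∑ s : ι → Bool, ∏ i, ghostWeight D (swapAt s z i) ≤ 2 ^ Fintype.card ι := by
  have hprod := Finset.prod_univ_sum (fun _ : ι => (Finset.univ : Finset Bool))
    fun i b => ghostWeight D (bif b then (z i).swap else z i)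
  rw [Fintype.piFinset_univ] at hprod
  calc ∑ s : ι → Bool, ∏ i, ghostWeight D (swapAt s z i)
      = ∏ i, (ghostWeight D (z i).swap + ghostWeight D (z i)) := by
        simpa only [Fintype.sum_bool, cond_true, cond_false, swapAt] using hprod.symm
    _ ≤ ∏ _i : ι, 2 := Finset.prod_le_prod' fun i _ => by
        rw [add_comm]
        exact ghostWeight_add_swap_le D (z i)
    _ = 2 ^ Fintype.card ι := by simp

theorem sum_iSup_prod_ghostWeight_swapAt_le [DecidableEq ι] (D : κ → Set Z) (z : ι → Z × Z) :
    ∑ s : ι → Bool, ⨆ k, ∏ i, ghostWeight (D k) (swapAt s z i)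
      ≤ 2 ^ Fintype.card ι * (Set.range fun k => doubleSample z ⁻¹' D k).ncard := by
  set f : κ → Set (ι ⊕ ι) := fun k => doubleSample z ⁻¹' D k
  have : Fintype (Set.range f) := Fintype.ofFinite _
  -- The weights of `D k` depend only on its trace, so one member per trace suffices.
  set rep : Set.range f → κ := Set.rangeSplitting f
  have hrep : ∀ k i s, ghostWeight (D k) (swapAt s z i)
      = ghostWeight (D (rep ⟨f k, k, rfl⟩)) (swapAt s z i) := fun k i s =>
    ghostWeight_swapAt_congr (Set.apply_rangeSplitting f ⟨f k, k, rfl⟩).symm s i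
  calc ∑ s : ι → Bool, ⨆ k, ∏ i, ghostWeight (D k) (swapAt s z i)
      ≤ ∑ s : ι → Bool, ∑ t, ∏ i, ghostWeight (D (rep t)) (swapAt s z i) := by
        refine Finset.sum_le_sum fun s _ => iSup_le fun k => ?_
        simp only [hrep k]
        exact Finset.single_le_sum (f := fun t => ∏ i, ghostWeight (D (rep t)) (swapAt s z i))
          (fun _ _ => zero_le) (Finset.mem_univ _)
    _ = ∑ t, ∑ s : ι → Bool, ∏ i, ghostWeight (D (rep t)) (swapAt s z i) := Finset.sum_comm
    _ ≤ ∑ _t : Set.range f, 2 ^ Fintype.card ι :=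
        Finset.sum_le_sum fun t _ => sum_prod_ghostWeight_swapAt_le (D (rep t)) z
    _ = 2 ^ Fintype.card ι * (Set.range f).ncard := by
        rw [Finset.sum_const, nsmul_eq_mul, mul_comm, Finset.card_univ, Set.fintypeCard_eq_ncard]

variable [MeasurableSpace Z]

theorem measurable_ghostWeight {D : Set Z} (hD : MeasurableSet D) :
    Measurable (ghostWeight D) :=
  ((measurable_one.indicator hD.compl).comp measurable_fst).mul
    (((measurable_one.indicator hD).comp measurable_snd).const_add 1)

theorem measurable_iSup_prod_ghostWeight [Countable κ] {D : κ → Set Z}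
    (hD : ∀ k, MeasurableSet (D k)) :
    Measurable fun z : ι → Z × Z => ⨆ k, ∏ i, ghostWeight (D k) (z i) :=
  .iSup fun k => Finset.measurable_prod _ fun i _ =>
    (measurable_ghostWeight (hD k)).comp (measurable_pi_apply i)

theorem measurableSet_exists_forall_notMem {ι : Type*} [Countable ι] [Countable κ] {D : κ → Set Z}
    (hD : ∀ k, MeasurableSet (D k)) (p : κ → Prop) :
    MeasurableSet {S : ι → Z | ∃ k, (∀ i, S i ∉ D k) ∧ p k} := by
  simp only [Set.ofPred_exists, Set.ofPred_and, Set.ofPred_forall]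
  exact .iUnion fun k => .inter
    (.iInter fun i => (hD k).compl.preimage (measurable_pi_apply i)) (.const _)

variable (P : Measure Z)

theorem measurePreserving_swapAt [SigmaFinite P] (s : ι → Bool) :
    MeasurePreserving (swapAt s) (Measure.pi fun _ : ι => P.prod P)
      (Measure.pi fun _ => P.prod P) := by
  refine measurePreserving_pi _ _ (f := fun i (q : Z × Z) => bif s i then q.swap else q) fun i => ?_
  cases s i
  · exact MeasurePreserving.id _
  · exact Measure.measurePreserving_swap

variable [IsProbabilityMeasure P]

theorem lintegral_pi_prod_eq_pow {f : Z → ℝ≥0∞} (hf : Measurable f) :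
    ∫⁻ S, ∏ i, f (S i) ∂(Measure.pi fun _ : ι => P) = (∫⁻ x, f x ∂P) ^ Fintype.card ι := by
  have heval : ∀ i : ι, ∫⁻ S, f (S i) ∂(Measure.pi fun _ : ι => P) = ∫⁻ x, f x ∂P := fun i =>
    (measurePreserving_eval (fun _ : ι => P) i).lintegral_comp hf
  rw [lintegral_prod_eq_prod_lintegral_of_indepFun Finset.univ (fun i (S : ι → Z) => f (S i))
    (iIndepFun_pi fun _ => hf.aemeasurable) fun i => hf.comp (measurable_pi_apply i)]
  simp only [heval, Finset.prod_const, Finset.card_univ]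

theorem lintegral_prod_ghostWeight_of_notMem {D : Set Z} (hD : MeasurableSet D) {S : ι → Z}
    (hS : ∀ i, S i ∉ D) :
    ∫⁻ S', ∏ i, ghostWeight D (S i, S' i) ∂(Measure.pi fun _ : ι => P)
      = (1 + P D) ^ Fintype.card ι := by
  have hweight : ∀ i x, ghostWeight D (S i, x) = 1 + D.indicator 1 x := fun i x => by
    simp [ghostWeight, hS i]
  simp only [hweight]
  rw [lintegral_pi_prod_eq_pow P ((measurable_one.indicator hD).const_add 1),
    lintegral_add_left measurable_const, lintegral_indicator_one hD]
  simp

variable [Countable κ] {D : κ → Set Z}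

theorem lintegral_iSup_prod_ghostWeight_le (hD : ∀ k, MeasurableSet (D k)) {Γ : ℕ}
    (hΓ : ∀ x : ι ⊕ ι → Z, (Set.range fun k => x ⁻¹' D k).ncard ≤ Γ) :
    ∫⁻ z, ⨆ k, ∏ i, ghostWeight (D k) (z i) ∂(Measure.pi fun _ : ι => P.prod P) ≤ Γ := by
  classical
  set μ := Measure.pi fun _ : ι => P.prod P
  set G : (ι → Z × Z) → ℝ≥0∞ := fun z => ⨆ k, ∏ i, ghostWeight (D k) (z i)
  have hG : Measurable G := measurable_iSup_prod_ghostWeight hD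
  have htotal : 2 ^ Fintype.card ι * ∫⁻ z, G z ∂μ ≤ 2 ^ Fintype.card ι * Γ := by
    calc 2 ^ Fintype.card ι * ∫⁻ z, G z ∂μ
        = ∑ s : ι → Bool, ∫⁻ z, G (swapAt s z) ∂μ := by
          simp [(measurePreserving_swapAt P _).lintegral_comp hG, μ]
      _ = ∫⁻ z, ∑ s : ι → Bool, G (swapAt s z) ∂μ :=
          (lintegral_finsetSum _ fun s _ => hG.comp (measurePreserving_swapAt P s).measurable).symm
      _ ≤ ∫⁻ _z, 2 ^ Fintype.card ι * Γ ∂μ := lintegral_mono fun z =>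
          (sum_iSup_prod_ghostWeight_swapAt_le D z).trans <| by
            gcongr
            exact_mod_cast hΓ (doubleSample z)
      _ = 2 ^ Fintype.card ι * Γ := by simp [μ]
  exact (ENNReal.mul_le_mul_iff_right (by simp) (by simp)).1 htotal

theorem measure_exists_forall_notMem_mul_le (hD : ∀ k, MeasurableSet (D k)) {Γ : ℕ}
    (hΓ : ∀ x : ι ⊕ ι → Z, (Set.range fun k => x ⁻¹' D k).ncard ≤ Γ) (r : ℝ≥0∞) :
    Measure.pi (fun _ : ι => P) {S | ∃ k, (∀ i, S i ∉ D k) ∧ r < P (D k)}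
      * (1 + r) ^ Fintype.card ι ≤ Γ := by
  set μ := Measure.pi fun _ : ι => P
  set B : Set (ι → Z) := {S | ∃ k, (∀ i, S i ∉ D k) ∧ r < P (D k)}
  set G : (ι → Z × Z) → ℝ≥0∞ := fun z => ⨆ k, ∏ i, ghostWeight (D k) (z i)
  have hpair : Measurable fun q : (ι → Z) × (ι → Z) => G fun i => (q.1 i, q.2 i) :=
    (measurable_iSup_prod_ghostWeight hD).comp (by fun_prop)
  have hlower : ∀ S, B.indicator (fun _ => (1 + r) ^ Fintype.card ι) S
      ≤ ∫⁻ S', G (fun i => (S i, S' i)) ∂μ := by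
    refine fun S => Set.indicator_apply_le' ?_ fun _ => zero_le
    rintro ⟨k, hk, hr⟩
    calc (1 + r) ^ Fintype.card ι ≤ (1 + P (D k)) ^ Fintype.card ι := by gcongr
      _ = ∫⁻ S', ∏ i, ghostWeight (D k) (S i, S' i) ∂μ :=
          (lintegral_prod_ghostWeight_of_notMem P (hD k) hk).symm
      _ ≤ ∫⁻ S', G (fun i => (S i, S' i)) ∂μ := lintegral_mono fun S' =>
          le_iSup (fun k => ∏ i, ghostWeight (D k) (S i, S' i)) k
  calc μ B * (1 + r) ^ Fintype.card ι
      = ∫⁻ S, B.indicator (fun _ => (1 + r) ^ Fintype.card ι) S ∂μ := by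
        rw [lintegral_indicator_const (measurableSet_exists_forall_notMem hD _), mul_comm]
    _ ≤ ∫⁻ S, ∫⁻ S', G (fun i => (S i, S' i)) ∂μ ∂μ := lintegral_mono hlower
    _ = ∫⁻ q, G (fun i => (q.1 i, q.2 i)) ∂(μ.prod μ) :=
        (lintegral_prod _ hpair.aemeasurable).symm
    _ = ∫⁻ z, G z ∂(Measure.pi fun _ : ι => P.prod P) :=
        ((measurePreserving_arrowProdEquivProdArrow Z Z ι (fun _ => P)
          (fun _ => P)).lintegral_comp hpair).symm
    _ ≤ Γ := lintegral_iSup_prod_ghostWeight_le P hD hΓ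

end GhostSample

/-! ### The class of half-spaces -/

section HalfSpaces

variable {E : Type*} [NormedAddCommGroup E] [InnerProductSpace ℝ E]

theorem card_le_finrank_of_shatters_halfSpaces [FiniteDimensional ℝ E] {α : Type*} [DecidableEq α]
    {v : α → E} {𝒜 : Finset (Finset α)}
    (h𝒜 : ∀ u ∈ 𝒜, ∃ θ : E, ∀ i, i ∈ u ↔ 0 ≤ inner ℝ (v i) θ) {s : Finset α}
    (hs : 𝒜.Shatters s) : s.card ≤ Module.finrank ℝ E := by
  by_contra! hcard
  have hdep : ¬ LinearIndependent ℝ fun i : s => v i := fun hli =>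
    hcard.not_ge (by simpa using hli.fintype_card_le_finrank)
  obtain ⟨g, hg, i₀, hi₀⟩ : ∃ g : s → ℝ, ∑ i, g i • v i = 0 ∧ ∃ i, g i < 0 := by
    obtain ⟨g, hg, i, hi⟩ := Fintype.not_linearIndependent_iff.1 hdep
    rcases lt_or_gt_of_ne hi with h | h
    · exact ⟨g, hg, i, h⟩
    · exact ⟨-g, by simpa [Finset.sum_neg_distrib] using hg, i, by simpa using h⟩
  -- A half-space with trace `{g ≥ 0}` on `s` contradicts the linear relation `g`.
  obtain ⟨u, hu, hsu⟩ := hs (Finset.map_subtype_subset {i : s | 0 ≤ g i})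
  obtain ⟨θ, hθ⟩ := h𝒜 u hu
  have hsign : ∀ i : s, 0 ≤ inner ℝ (v i) θ ↔ 0 ≤ g i := fun i => by
    simpa [hθ] using Finset.ext_iff.1 hsu i
  have hzero : ∑ i, g i * inner ℝ (v i) θ = 0 := by
    simpa [sum_inner, real_inner_smul_left] using congrArg (inner ℝ · θ) hg
  have hpos : 0 < ∑ i, g i * inner ℝ (v i) θ := by
    refine Finset.sum_pos' (fun i _ => ?_) ⟨i₀, Finset.mem_univ _, ?_⟩
    · rcases le_or_gt 0 (g i) with hi | hi
      · exact mul_nonneg hi ((hsign i).2 hi)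
      · exact mul_nonneg_of_nonpos_of_nonpos hi.le (not_le.1 (mt (hsign i).1 hi.not_ge)).le
    · exact mul_pos_of_neg_of_neg hi₀ (not_le.1 (mt (hsign i₀).1 hi₀.not_ge))
  exact hpos.ne' hzero

theorem sum_choose_le_add_one_pow (N m : ℕ) :
    ∑ k ∈ Finset.Iic m, N.choose k ≤ (N + 1) ^ m := by
  rw [add_pow, ← Nat.range_succ_eq_Iic]
  refine Finset.sum_le_sum fun k hk => ?_
  calc N.choose k ≤ N ^ k := Nat.choose_le_pow N k
    _ ≤ N ^ k * 1 ^ (m - k) * m.choose k := by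
      rw [one_pow, mul_one]
      exact Nat.le_mul_of_pos_right _ (Nat.choose_pos (Finset.mem_range_succ_iff.1 hk))

theorem ncard_range_halfSpace_le [FiniteDimensional ℝ E] {α : Type*} [Fintype α] (v : α → E) :
    (Set.range fun θ : E => {i | 0 ≤ inner ℝ (v i) θ}).ncard
      ≤ (Fintype.card α + 1) ^ Module.finrank ℝ E := by
  classical
  set 𝒜 : Finset (Finset α) := {u | ∃ θ : E, ∀ i, i ∈ u ↔ 0 ≤ inner ℝ (v i) θ}
  have hdim : 𝒜.vcDim ≤ Module.finrank ℝ E := Finset.sup_le fun s hs =>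
    card_le_finrank_of_shatters_halfSpaces (fun u hu => (Finset.mem_filter.1 hu).2)
      (Finset.mem_shatterer.1 hs)
  have hrange : (Set.range fun θ : E => {i | 0 ≤ inner ℝ (v i) θ})
      ⊆ (fun u : Finset α => (u : Set α)) '' 𝒜 := by
    rintro _ ⟨θ, rfl⟩
    exact ⟨Finset.univ.filter fun i => 0 ≤ inner ℝ (v i) θ,
      by simpa [𝒜] using ⟨θ, fun _ => Iff.rfl⟩, by simp⟩
  calc (Set.range fun θ : E => {i | 0 ≤ inner ℝ (v i) θ}).ncard
      ≤ 𝒜.card := (Set.ncard_le_ncard hrange (Set.toFinite _)).trans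
        ((Set.ncard_image_le (Set.toFinite _)).trans_eq (Set.ncard_coe_finset 𝒜))
    _ ≤ ∑ k ∈ Finset.Iic 𝒜.vcDim, (Fintype.card α).choose k :=
        𝒜.card_le_card_shatterer.trans Finset.card_shatterer_le_sum_vcDim
    _ ≤ ∑ k ∈ Finset.Iic (Module.finrank ℝ E), (Fintype.card α).choose k :=
        Finset.sum_le_sum_of_subset (Finset.Iic_subset_Iic.2 hdim)
    _ ≤ (Fintype.card α + 1) ^ Module.finrank ℝ E := sum_choose_le_add_one_pow _ _

variable {X : Type*}

/-- The labelled points that the half-space with normal vector `θ`, in the features `v`, gets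
wrong. -/
def halfSpaceErrors (v : X → E) (θ : E) : Set (X × ℤˣ) :=
  {z | sgn (inner ℝ (v z.1) θ) ≠ z.2}

theorem ncard_range_preimage_halfSpaceErrors_le [FiniteDimensional ℝ E] {κ α : Type*} [Fintype α]
    (v : X → E) (θ : κ → E) (x : α → X × ℤˣ) :
    (Set.range fun k => x ⁻¹' halfSpaceErrors v (θ k)).ncard
      ≤ (Fintype.card α + 1) ^ Module.finrank ℝ E := by
  classical
  set φ : Set α → Set α := fun u => {i | (if i ∈ u then (1 : ℤˣ) else -1) ≠ (x i).2}
  have hrange : (Set.range fun k => x ⁻¹' halfSpaceErrors v (θ k))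
      ⊆ φ '' Set.range fun θ : E => {i | 0 ≤ inner ℝ (v (x i).1) θ} := by
    rintro _ ⟨k, rfl⟩
    exact ⟨_, ⟨θ k, rfl⟩, rfl⟩
  exact ((Set.ncard_le_ncard hrange (Set.toFinite _)).trans
    (Set.ncard_image_le (Set.toFinite _))).trans (ncard_range_halfSpace_le fun i => v (x i).1)

theorem exists_tendsto_sgn_inner {κ : Type*} {q : κ → E} (hq : DenseRange q) (e θ : E) :
    ∃ m : ℕ → κ, ∀ u : E, 0 < inner ℝ u e →
      ∀ᶠ j in atTop, sgn (inner ℝ u (q (m j))) = sgn (inner ℝ u θ) := by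
  set t : ℕ → ℝ := fun j => 1 / ((j : ℝ) + 1)
  have ht₀ : ∀ j, 0 < t j := fun j => Nat.one_div_pos_of_nat
  have ht : Tendsto t atTop (𝓝 0) := tendsto_one_div_add_atTop_nhds_zero_nat
  -- The error `t j ^ 2` is negligible compared to the shift `t j • e` in the positive direction.
  choose m hm using fun j => hq.exists_dist_lt (θ + t j • e) (pow_pos (ht₀ j) 2)
  refine ⟨m, fun u hu => ?_⟩
  have hclose : ∀ j, |inner ℝ u θ + t j * inner ℝ u e - inner ℝ u (q (m j))|
      ≤ t j ^ 2 * ‖u‖ := fun j => by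
    rw [← real_inner_smul_right, ← inner_add_right, ← inner_sub_right, mul_comm]
    refine (abs_real_inner_le_norm u _).trans (mul_le_mul_of_nonneg_left ?_ (norm_nonneg u))
    rw [← dist_eq_norm]
    exact (hm j).le
  rcases le_or_gt 0 (inner ℝ u θ) with hθ | hθ
  · have hsmall : Tendsto (fun j => t j * ‖u‖) atTop (𝓝 0) := by simpa using ht.mul_const ‖u‖
    filter_upwards [hsmall.eventually_lt_const hu] with j hj
    have hnonneg : 0 ≤ inner ℝ u (q (m j)) := by
      nlinarith [(abs_le.1 (hclose j)).2, mul_pos (ht₀ j) (sub_pos.2 hj)]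
    rw [sgn, sgn, if_pos hθ, if_pos hnonneg]
  · have hbound : Tendsto (fun j => inner ℝ u θ + t j * inner ℝ u e + t j ^ 2 * ‖u‖) atTop
        (𝓝 (inner ℝ u θ)) := by
      simpa using ((ht.mul_const (inner ℝ u e)).const_add (inner ℝ u θ)).add
        ((ht.pow 2).mul_const ‖u‖)
    filter_upwards [hbound.eventually_lt_const hθ] with j hj
    have hneg : inner ℝ u (q (m j)) < 0 := by linarith [(abs_le.1 (hclose j)).1]
    rw [sgn, sgn, if_neg hθ.not_ge, if_neg hneg.not_ge]

instance measurableSingletonClass_int_units : MeasurableSingletonClass ℤˣ where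
  measurableSet_singleton u := by
    have hpre : ({u} : Set ℤˣ) = Units.val ⁻¹' {(u : ℤ)} := by
      ext
      simp [Units.ext_iff]
    rw [hpre]
    exact measurableSet_preimage (comap_measurable _) (.singleton _)

theorem measurable_sgn : Measurable sgn :=
  .ite measurableSet_Ici measurable_const measurable_const

variable [MeasurableSpace X] [MeasurableSpace E] [BorelSpace E] {v : X → E}

theorem measurableSet_halfSpaceErrors [SecondCountableTopology E] (hv : Measurable v) (θ : E) :
    MeasurableSet (halfSpaceErrors v θ) := by
  have hsgn : Measurable fun z : X × ℤˣ => sgn (inner ℝ (v z.1) θ) :=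
    measurable_sgn.comp ((hv.comp measurable_fst).inner_const)
  exact (measurableSet_eq_fun hsgn measurable_snd).compl

theorem exists_halfSpaceErrors_of_denseRange [SecondCountableTopology E] {κ : Type*} {q : κ → E}
    (hq : DenseRange q) (hv : Measurable v) {e : E} (he : ∀ x, 0 < inner ℝ (v x) e)
    (P : Measure (X × ℤˣ)) [IsFiniteMeasure P] {ι : Type*} [Finite ι] (S : ι → X × ℤˣ)
    {θ : E} {r : ℝ≥0∞} (hS : ∀ i, S i ∉ halfSpaceErrors v θ) (hr : r < P (halfSpaceErrors v θ)) :
    ∃ k, (∀ i, S i ∉ halfSpaceErrors v (q k)) ∧ r < P (halfSpaceErrors v (q k)) := by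
  obtain ⟨m, hm⟩ := exists_tendsto_sgn_inner hq e θ
  have hlim : ∀ z : X × ℤˣ, ∀ᶠ j in atTop,
      (z ∈ halfSpaceErrors v (q (m j)) ↔ z ∈ halfSpaceErrors v θ) := fun z => by
    filter_upwards [hm (v z.1) (he z.1)] with j hj
    simp only [halfSpaceErrors, Set.mem_ofPred_eq, hj]
  have hmeasure := tendsto_measure_of_tendsto_indicator_of_isFiniteMeasure atTop P
    (fun j => measurableSet_halfSpaceErrors hv (q (m j))) hlim
  obtain ⟨j, hj, hSj⟩ := ((hmeasure.eventually_const_lt hr).and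
    (eventually_all.2 fun i => hlim (S i))).exists
  exact ⟨m j, fun i => mt (hSj i).1 (hS i), hj⟩

theorem measure_exists_halfSpace_mul_le [FiniteDimensional ℝ E] (hv : Measurable v) {e : E}
    (he : ∀ x, 0 < inner ℝ (v x) e) (P : Measure (X × ℤˣ)) [IsProbabilityMeasure P]
    {ι : Type*} [Fintype ι] (r : ℝ≥0∞) :
    Measure.pi (fun _ : ι => P)
        {S | ∃ θ, (∀ i, S i ∉ halfSpaceErrors v θ) ∧ r < P (halfSpaceErrors v θ)}
      * (1 + r) ^ Fintype.card ι ≤ ((2 * Fintype.card ι + 1) ^ Module.finrank ℝ E : ℕ) := by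
  have hcount := measure_exists_forall_notMem_mul_le P (ι := ι)
    (fun k => measurableSet_halfSpaceErrors hv (TopologicalSpace.denseSeq E k))
    (fun x => ncard_range_preimage_halfSpaceErrors_le v _ x) r
  rw [Fintype.card_sum, ← two_mul] at hcount
  refine le_trans ?_ hcount
  gcongr
  rintro ⟨θ, hS, hr⟩
  exact exists_halfSpaceErrors_of_denseRange (TopologicalSpace.denseRange_denseSeq E) hv he P _
    hS hr

end HalfSpaces

/-! ### Sample complexity of empirical risk minimization -/

section EmpiricalRiskMinimization

theorem half_le_log_one_add {ε : ℝ} (hε : 0 ≤ ε) (hε1 : ε ≤ 1) : ε / 2 ≤ Real.log (1 + ε) := by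
  refine le_trans ?_ (Real.one_sub_inv_le_log_of_pos (by linarith))
  have hinv : (1 + ε)⁻¹ ≤ 1 - ε / 2 := by
    rw [inv_le_iff_one_le_mul₀' (by linarith)]
    nlinarith
  linarith

theorem cube_le_mul_pow_of_log_le {n : ℕ} {ε δ : ℝ} (hε : 0 ≤ ε) (hε1 : ε ≤ 1) (hδ : 0 < δ)
    (h : 3 * Real.log (2 * n + 1) + Real.log (1 / δ) ≤ n * (ε / 2)) :
    (2 * n + 1 : ℝ) ^ 3 ≤ δ * (1 + ε) ^ n := by
  have hpow : (0 : ℝ) < (1 + ε) ^ n := by positivity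
  rw [← Real.log_le_log_iff (by positivity) (mul_pos hδ hpow), Real.log_pow,
    Real.log_mul hδ.ne' hpow.ne', Real.log_pow]
  have hlog : (n : ℝ) * (ε / 2) ≤ n * Real.log (1 + ε) := by
    gcongr
    exact half_le_log_one_add hε hε1
  rw [one_div, Real.log_inv] at h
  push_cast
  linarith

theorem exists_sampleSize {ε δ : ℝ} (hε : 0 < ε) (hε2 : ε ≤ 1 / 2) (hδ : 0 < δ) (hδ1 : δ < 1) :
    ∃ n : ℕ, (n : ℝ) ≤ 130 * (1 / ε * (Real.log (1 / ε) + Real.log (1 / δ))) ∧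
      (2 * n + 1 : ℝ) ^ 3 ≤ δ * (1 + ε) ^ n := by
  set L := Real.log (1 / ε) + Real.log (1 / δ)
  have hlogδ : 0 < Real.log (1 / δ) := Real.log_pos (one_lt_one_div hδ hδ1)
  have hinv : 2 ≤ 1 / ε := (le_one_div two_pos hε).2 hε2
  have hlogε : Real.log 2 ≤ Real.log (1 / ε) := Real.log_le_log two_pos hinv
  have hlog2 := Real.log_two_gt_d9
  have hLpos : 0 < L := by linarith
  have hLε : 1 ≤ 1 / ε * L := by nlinarith
  set n := ⌈128 * (1 / ε * L)⌉₊
  have hn_ge : 128 * (1 / ε * L) ≤ n := Nat.le_ceil _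
  have hn_lt : (n : ℝ) < 128 * (1 / ε * L) + 1 := Nat.ceil_lt_add_one (by positivity)
  have hlog_n : Real.log (2 * n + 1) ≤ 11 * L := by
    calc Real.log (2 * n + 1) ≤ Real.log (2 ^ 9 * (1 / ε * L)) :=
          Real.log_le_log (by positivity) (by linarith)
      _ = 9 * Real.log 2 + (Real.log (1 / ε) + Real.log L) := by
          rw [Real.log_mul (by positivity) (by positivity),
            Real.log_mul (by positivity) hLpos.ne', Real.log_pow]
          norm_num
      _ ≤ 11 * L := by linarith [Real.log_le_sub_one_of_pos hLpos]
  have hnε : 64 * L ≤ n * (ε / 2) := by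
    calc 64 * L = 128 * (1 / ε * L) * (ε / 2) := by field_simp; norm_num
      _ ≤ n * (ε / 2) := by gcongr
  exact ⟨n, by linarith, cube_le_mul_pow_of_log_le hε.le (by linarith) hδ (by linarith)⟩

variable {X : Type*}

theorem IsERM.forall_eq {F : Set (X → ℤˣ)} {A : (n : ℕ) → Dataset X n → (X → ℤˣ)}
    (hA : IsERM F A) {n : ℕ} {S : Dataset X n} {h : X → ℤˣ} (hF : h ∈ F)
    (hS : ∀ i, h (S i).1 = (S i).2) (i : Fin n) : A n S (S i).1 = (S i).2 := by
  have hzero : empiricalErrors S h = 0 := by simp [empiricalErrors, hS]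
  have herrors := (hA n S).2 h hF
  rw [hzero, Nat.le_zero, empiricalErrors, Finset.card_eq_zero,
    Finset.filter_eq_empty_iff] at herrors
  exact not_not.1 (herrors (Finset.mem_univ i))

theorem measurableSet_apply_ne (x : X) (y : ℤˣ) : MeasurableSet {h : X → ℤˣ | h x ≠ y} :=
  (measurableSet_eq_fun (measurable_pi_apply x) measurable_const).compl

variable [MeasurableSpace X]

theorem err_deterministic (P : Measure (X × ℤˣ)) {A : (n : ℕ) → Dataset X n → (X → ℤˣ)} {n : ℕ}
    {S : Dataset X n} (hA : MeasurableSet {z : X × ℤˣ | A n S z.1 ≠ z.2}) :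
    err P (deterministic A n S) = P {z | A n S z.1 ≠ z.2} := by
  rw [err, ← lintegral_indicator_one hA]
  refine lintegral_congr fun z => ?_
  change Measure.dirac (A n S) {h : X → ℤˣ | h z.1 ≠ z.2} = _
  rw [Measure.dirac_apply' _ (measurableSet_apply_ne z.1 z.2)]
  rfl

variable {h : X → ℤˣ} (hh : Measurable h)
include hh

theorem ae_pi_label_eq {PX : Measure X} [IsProbabilityMeasure PX] {ι : Type*} [Fintype ι] :
    ∀ᵐ S ∂(Measure.pi fun _ : ι => PX.map fun x => (x, h x)), ∀ i, h (S i).1 = (S i).2 := by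
  have hgraph : Measurable fun x => (x, h x) := measurable_id.prodMk hh
  have := Measure.isProbabilityMeasure_map (μ := PX) hgraph.aemeasurable
  have hlabel : ∀ᵐ z ∂(PX.map fun x => (x, h x)), h z.1 = z.2 := by
    have hset : MeasurableSet {z : X × ℤˣ | h z.1 = z.2} :=
      measurableSet_eq_fun (hh.comp measurable_fst) measurable_snd
    exact (ae_map_iff hgraph.aemeasurable hset).2 (.of_forall fun _ => rfl)
  exact ae_all_iff.2 fun i =>
    (measurePreserving_eval (fun _ : ι => PX.map fun x => (x, h x)) i).quasiMeasurePreserving.ae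
      hlabel

variable {E : Type*} [NormedAddCommGroup E] [InnerProductSpace ℝ E] [FiniteDimensional ℝ E]
  [MeasurableSpace E] [BorelSpace E] {v : X → E} (hv : Measurable v) {e : E}
  (he : ∀ x, 0 < inner ℝ (v x) e) {F : Set (X → ℤˣ)}
  (hF : ∀ f ∈ F, ∃ θ, ∀ x, f x = sgn (inner ℝ (v x) θ)) (hhF : h ∈ F)
  {A : (n : ℕ) → Dataset X n → (X → ℤˣ)} (hA : IsERM F A)
include hv he hF hhF hA

theorem measure_lt_err_mul_le {P : Measure (X × ℤˣ)} (hP : P ∈ allDistributions h) (n : ℕ)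
    (r : ℝ≥0∞) :
    Measure.pi (fun _ : Fin n => P) {S | r < err P (deterministic A n S)} * (1 + r) ^ n
      ≤ ((2 * n + 1) ^ Module.finrank ℝ E : ℕ) := by
  obtain ⟨PX, hPX, rfl⟩ := hP
  have : IsProbabilityMeasure (PX.map fun x => (x, h x)) :=
    Measure.isProbabilityMeasure_map (measurable_id.prodMk hh).aemeasurable
  have hunif := measure_exists_halfSpace_mul_le hv he (PX.map fun x => (x, h x)) (ι := Fin n) r
  rw [Fintype.card_fin] at hunif
  refine le_trans (mul_le_mul_left ?_ _) hunif
  refine measure_mono_ae ?_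
  filter_upwards [ae_pi_label_eq hh] with S hS (hbad : r < err _ (deterministic A n S))
  obtain ⟨θ, hθ⟩ := hF _ (hA n S).1
  have herrors : {z : X × ℤˣ | A n S z.1 ≠ z.2} = halfSpaceErrors v θ := by
    simp only [halfSpaceErrors, hθ]
  refine ⟨θ, fun i => ?_, ?_⟩
  · rw [← herrors]
    exact not_not.2 (hA.forall_eq hhF hS i)
  · rwa [err_deterministic _ (herrors ▸ measurableSet_halfSpaceErrors hv θ), herrors] at hbad

theorem sampleComplexity_le_of_isERM (hdim : Module.finrank ℝ E = 3) {ε δ : ℝ} (hε : 0 < ε)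
    (hε2 : ε ≤ 1 / 2) (hδ : 0 < δ) (hδ1 : δ < 1) :
    ((sampleComplexity (deterministic A) (allDistributions h) ε δ : ℕ∞) : ℝ≥0∞) ≤
      ENNReal.ofReal (130 * (1 / ε * (Real.log (1 / ε) + Real.log (1 / δ)))) := by
  obtain ⟨n, hn, hcube⟩ := exists_sampleSize hε hε2 hδ hδ1
  have hle : sampleComplexity (deterministic A) (allDistributions h) ε δ ≤ n := by
    refine sInf_le ⟨n, fun P hP => ?_, rfl⟩
    have htail := measure_lt_err_mul_le hh hv he hF hhF hA hP n (ENNReal.ofReal ε)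
    rw [hdim] at htail
    have hsize : (((2 * n + 1) ^ 3 : ℕ) : ℝ≥0∞)
        ≤ ENNReal.ofReal δ * (1 + ENNReal.ofReal ε) ^ n := by
      rw [← ENNReal.ofReal_one, ← ENNReal.ofReal_add zero_le_one hε.le,
        ← ENNReal.ofReal_pow (by positivity), ← ENNReal.ofReal_mul hδ.le,
        ← ENNReal.ofReal_natCast]
      exact ENNReal.ofReal_le_ofReal (mod_cast hcube)
    exact (ENNReal.mul_le_mul_iff_left (by simp) (by finiteness)).1 (htail.trans hsize)
  calc ((sampleComplexity (deterministic A) (allDistributions h) ε δ : ℕ∞) : ℝ≥0∞)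
      ≤ ((n : ℕ∞) : ℝ≥0∞) := ENat.toENNReal_mono hle
    _ = ENNReal.ofReal n := by simp
    _ ≤ _ := ENNReal.ofReal_le_ofReal hn

end EmpiricalRiskMinimization

section SquareNetworkERM

variable {r p d : ℕ}

theorem measurable_feature_squarePool (w : Fin 1 → ℝ) :
    Measurable (feature (r := r) (p := p) squarePool w) := by
  refine (WithLp.measurable_toLp 2 _).comp (measurable_pi_iff.2 fun o => ?_)
  cases o with
  | none => exact measurable_const
  | some i =>
    simp only [Option.elim_some, squarePool_conv, blockSq]
    fun_prop

theorem exists_eq_sgn_inner_feature {f : EuclideanSpace ℝ (Fin (r * p)) → ℤˣ}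
    (hf : f ∈ cnnClass 1 r p squarePool) :
    ∃ θ, ∀ x, f x = sgn (inner ℝ (feature squarePool (1 : Fin 1 → ℝ) x) θ) := by
  obtain ⟨W, rfl⟩ := hf
  refine ⟨secondLayer (fun i => W.2.1 i * W.1 0 ^ 2, W.2.2), fun x => ?_⟩
  simp [inner_feature_secondLayer, cnn_squarePool, mul_assoc]

theorem measurable_target : Measurable (target d) := by
  rw [funext target_eq_sgn_blockSq]
  unfold blockSq
  exact measurable_sgn.comp (by fun_prop)

theorem sampleComplexity_cnn_le
    {A : (n : ℕ) → Dataset (EuclideanSpace ℝ (Fin (2 * d))) n →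
      (EuclideanSpace ℝ (Fin (2 * d)) → ℤˣ)} (hA : IsERM (cnnClass 1 2 d squarePool) A)
    {ε δ : ℝ} (hε : 0 < ε) (hε2 : ε ≤ 1 / 2) (hδ : 0 < δ) (hδ1 : δ < 1) :
    ((sampleComplexity (deterministic A) (allDistributions (target d)) ε δ : ℕ∞) : ℝ≥0∞) ≤
      ENNReal.ofReal (130 * (1 / ε * (Real.log (1 / ε) + Real.log (1 / δ)))) :=
  sampleComplexity_le_of_isERM measurable_target (measurable_feature_squarePool 1)
    (e := secondLayer (0, 1)) (fun x => by simp [inner_feature_secondLayer, cnn])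
    (fun _ => exists_eq_sgn_inner_feature) target_mem_cnnClass hA (by simp) hε hε2 hδ hδ1

end SquareNetworkERM

/-! ### Orthogonal matrices with prescribed signs above the diagonal -/

section MatrixExp

variable {ι : Type*} [Fintype ι] [DecidableEq ι]

theorem exp_mem_orthogonalGroup {B : Matrix ι ι ℝ} (hB : B.transpose = -B) :
    NormedSpace.exp B ∈ Matrix.orthogonalGroup ι ℝ := by
  rw [Matrix.mem_orthogonalGroup_iff', ← Matrix.exp_transpose, hB, Matrix.exp_neg,
    Matrix.nonsing_inv_mul _ ((Matrix.isUnit_iff_isUnit_det _).1 (Matrix.isUnit_exp B))]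

open scoped Matrix.Norms.Operator in
theorem tendsto_exp_smul_apply (B : Matrix ι ι ℝ) {i j : ι} (hij : i ≠ j) :
    Tendsto (fun t : ℝ => t⁻¹ * NormedSpace.exp (t • B) i j) (𝓝[>] 0) (𝓝 (B i j)) := by
  have hderiv := hasDerivAt_exp_smul_const B (0 : ℝ)
  rw [zero_smul, NormedSpace.exp_zero, one_mul] at hderiv
  have hslope := tendsto_pi_nhds.1 (tendsto_pi_nhds.1 hderiv.tendsto_slope_zero_right i) j
  refine hslope.congr fun t => ?_
  rw [zero_add, zero_smul, NormedSpace.exp_zero]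
  change t⁻¹ * (NormedSpace.exp (t • B) i j - (1 : Matrix ι ι ℝ) i j) = _
  rw [Matrix.one_apply_ne hij, sub_zero]

end MatrixExp

section SignMatrix

variable {ι : Type*} [LinearOrder ι]

/-- The skew-symmetric matrix whose entry at `(i, j)` is the sign `b i j` whenever `i < j`. -/
def skewSignMatrix (b : ι → ι → ℤˣ) : Matrix ι ι ℝ :=
  Matrix.of fun i j => if i < j then ((b i j : ℤ) : ℝ) else if j < i then -((b j i : ℤ) : ℝ) else 0

theorem skewSignMatrix_of_lt (b : ι → ι → ℤˣ) {i j : ι} (hij : i < j) :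
    skewSignMatrix b i j = ((b i j : ℤ) : ℝ) := if_pos hij

theorem transpose_skewSignMatrix (b : ι → ι → ℤˣ) :
    (skewSignMatrix b).transpose = -skewSignMatrix b := by
  ext i j
  rcases lt_trichotomy i j with h | rfl | h
  · simp [skewSignMatrix, h, h.not_gt]
  · simp [skewSignMatrix]
  · simp [skewSignMatrix, h, h.not_gt]

variable [Fintype ι]

theorem eventually_sgn_exp_smul_skewSignMatrix_eq (b : ι → ι → ℤˣ) {i j : ι} (hij : i < j) :
    ∀ᶠ t in 𝓝[>] (0 : ℝ), sgn (NormedSpace.exp (t • skewSignMatrix b) i j) = b i j := by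
  have hlim := (tendsto_exp_smul_apply (skewSignMatrix b) hij.ne).const_mul ((b i j : ℤ) : ℝ)
  have hone : ((b i j : ℤ) : ℝ) * skewSignMatrix b i j = 1 := by
    rw [skewSignMatrix_of_lt b hij]
    exact_mod_cast Int.units_coe_mul_self (b i j)
  rw [hone] at hlim
  filter_upwards [hlim.eventually_const_lt one_pos, self_mem_nhdsWithin] with t hpos ht
  rw [mul_left_comm] at hpos
  exact sgn_eq_of_mul_pos (pos_of_mul_pos_right hpos (inv_pos.2 ht).le)

theorem exists_mem_orthogonalGroup_sgn_eq (b : ι → ι → ℤˣ) :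
    ∃ Q ∈ Matrix.orthogonalGroup ι ℝ, ∀ i j, i < j → sgn (Q i j) = b i j := by
  have hsgn : ∀ᶠ t in 𝓝[>] (0 : ℝ), ∀ i j, i < j →
      sgn (NormedSpace.exp (t • skewSignMatrix b) i j) = b i j :=
    eventually_all.2 fun i => eventually_all.2 fun j => eventually_imp_distrib_left.2
      (eventually_sgn_exp_smul_skewSignMatrix_eq b)
  obtain ⟨t, ht⟩ := hsgn.exists
  refine ⟨_, exp_mem_orthogonalGroup ?_, ht⟩
  rw [Matrix.transpose_smul, transpose_skewSignMatrix, smul_neg]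

end SignMatrix

/-! ### Orthogonal maps that move the target -/

section Rotations

variable {F : Type*} [NormedAddCommGroup F] [InnerProductSpace ℝ F]

theorem norm_sq_inv_sqrt_two_smul (v : F) : ‖(√2)⁻¹ • v‖ ^ 2 = ‖v‖ ^ 2 / 2 := by
  rw [norm_smul, mul_pow, Real.norm_eq_abs, sq_abs, inv_pow, Real.sq_sqrt zero_le_two]
  ring

/-- The isometry `(u, v) ↦ ((u + U v) / √2, (u - U v) / √2)` of `F × F`. It transforms the quadratic
form `‖u‖² - ‖v‖²` into the bilinear form `2 ⟨u, U v⟩`. -/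
def mixBlocks (U : F →ₗᵢ[ℝ] F) : WithLp 2 (F × F) →ₗᵢ[ℝ] WithLp 2 (F × F) where
  toFun x := WithLp.toLp 2 ((√2)⁻¹ • (x.fst + U x.snd), (√2)⁻¹ • (x.fst - U x.snd))
  map_add' x y := WithLp.ofLp_injective 2 <| Prod.ext
    (by simp only [WithLp.add_fst, WithLp.add_snd, map_add, WithLp.ofLp_add, Prod.fst_add]; module)
    (by simp only [WithLp.add_fst, WithLp.add_snd, map_add, WithLp.ofLp_add, Prod.snd_add]; module)
  map_smul' c x := WithLp.ofLp_injective 2 <| Prod.ext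
    (by simp only [WithLp.smul_fst, WithLp.smul_snd, map_smul, WithLp.ofLp_smul, Prod.smul_fst,
      RingHom.id_apply]; module)
    (by simp only [WithLp.smul_fst, WithLp.smul_snd, map_smul, WithLp.ofLp_smul, Prod.smul_snd,
      RingHom.id_apply]; module)
  norm_map' x := by
    rw [← sq_eq_sq₀ (norm_nonneg _) (norm_nonneg _), WithLp.prod_norm_sq_eq_of_L2,
      WithLp.prod_norm_sq_eq_of_L2]
    change ‖(√2)⁻¹ • (x.fst + U x.snd)‖ ^ 2 + ‖(√2)⁻¹ • (x.fst - U x.snd)‖ ^ 2 = _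
    rw [norm_sq_inv_sqrt_two_smul, norm_sq_inv_sqrt_two_smul, ← add_div,
      parallelogram_law_with_norm ℝ, U.norm_map]
    ring

theorem norm_sq_mixBlocks_sub (U : F →ₗᵢ[ℝ] F) (x : WithLp 2 (F × F)) :
    ‖(mixBlocks U x).fst‖ ^ 2 - ‖(mixBlocks U x).snd‖ ^ 2 = 2 * inner ℝ x.fst (U x.snd) := by
  change ‖(√2)⁻¹ • (x.fst + U x.snd)‖ ^ 2 - ‖(√2)⁻¹ • (x.fst - U x.snd)‖ ^ 2 = _
  rw [norm_sq_inv_sqrt_two_smul, norm_sq_inv_sqrt_two_smul, norm_add_sq_real, norm_sub_sq_real]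
  ring

variable {d : ℕ}

/-- The decomposition of a vector of `ℝ^{2d}` into its two halves. -/
def halves (d : ℕ) : EuclideanSpace ℝ (Fin (2 * d)) ≃ₗᵢ[ℝ]
    WithLp 2 (EuclideanSpace ℝ (Fin d) × EuclideanSpace ℝ (Fin d)) :=
  (LinearIsometryEquiv.piLpCongrLeft 2 ℝ ℝ ((finCongr (two_mul d)).trans finSumFinEquiv.symm)).trans
    (PiLp.sumPiLpEquivProdLpPiLp 2 fun _ => ℝ)

theorem target_eq_sgn_halves (x : EuclideanSpace ℝ (Fin (2 * d))) :
    target d x = sgn (‖(halves d x).fst‖ ^ 2 - ‖(halves d x).snd‖ ^ 2) := by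
  have hfst (l : Fin d) : (halves d x).fst l = x (finProdFinEquiv (0, l)) :=
    congrArg x (Fin.ext (by simp))
  have hsnd (l : Fin d) : (halves d x).snd l = x (finProdFinEquiv (1, l)) :=
    congrArg x (Fin.ext (by simp [add_comm]))
  simp only [target_eq_sgn_blockSq, EuclideanSpace.real_norm_sq_eq, blockSq, hfst, hsnd]

theorem exists_target_halves_symm_eq
    (U : EuclideanSpace ℝ (Fin d) →ₗᵢ[ℝ] EuclideanSpace ℝ (Fin d)) :
    ∃ g : EuclideanSpace ℝ (Fin (2 * d)) ≃ₗᵢ[ℝ] EuclideanSpace ℝ (Fin (2 * d)),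
      ∀ u v, target d (g ((halves d).symm (WithLp.toLp 2 (u, v)))) = sgn (inner ℝ u (U v)) := by
  refine ⟨(halves d).trans (((mixBlocks U).toLinearIsometryEquiv rfl).trans (halves d).symm),
    fun u v => ?_⟩
  rw [target_eq_sgn_halves]
  simp [norm_sq_mixBlocks_sub, sgn_mul_of_pos]

theorem exists_target_eq_of_unit (hd : 1 ≤ d) : ∃ x : EuclideanSpace ℝ (Fin (2 * d)), ∀ y : ℤˣ,
    ∃ g : EuclideanSpace ℝ (Fin (2 * d)) ≃ₗᵢ[ℝ] EuclideanSpace ℝ (Fin (2 * d)),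
      target d (g x) = y := by
  set e : EuclideanSpace ℝ (Fin d) := EuclideanSpace.single ⟨0, hd⟩ 1
  refine ⟨(halves d).symm (WithLp.toLp 2 (e, e)), fun y => ?_⟩
  rcases Int.units_eq_one_or y with rfl | rfl
  · obtain ⟨g, hg⟩ := exists_target_halves_symm_eq (d := d) .id
    exact ⟨g, by simp [hg, e, sgn]⟩
  · obtain ⟨g, hg⟩ := exists_target_halves_symm_eq (d := d)
      (LinearIsometryEquiv.neg ℝ).toLinearIsometry
    exact ⟨g, by simp [hg, e, sgn]⟩

theorem exists_linearIsometry_inner_single_eq {ι : Type*} [Fintype ι] [DecidableEq ι]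
    {Q : Matrix ι ι ℝ} (hQ : Q ∈ Matrix.orthogonalGroup ι ℝ) :
    ∃ U : EuclideanSpace ℝ ι →ₗᵢ[ℝ] EuclideanSpace ℝ ι, ∀ i j,
      inner ℝ (EuclideanSpace.single i 1) (U (EuclideanSpace.single j 1)) = Q i j := by
  refine ⟨⟨Q.toEuclideanLin, fun v => ?_⟩, fun i j => ?_⟩
  · rw [← sq_eq_sq₀ (norm_nonneg _) (norm_nonneg _), ← real_inner_self_eq_norm_sq,
      ← real_inner_self_eq_norm_sq, EuclideanSpace.inner_eq_star_dotProduct,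
      EuclideanSpace.inner_eq_star_dotProduct]
    simp [Matrix.dotProduct_mulVec, ← Matrix.mulVec_transpose, Matrix.mulVec_mulVec,
      (Matrix.mem_orthogonalGroup_iff' ι ℝ).1 hQ]
  · change inner ℝ (EuclideanSpace.single i 1) (Q.toEuclideanLin (EuclideanSpace.single j 1)) = _
    simp [EuclideanSpace.inner_single_left]

/-- Pairs `i < j` of indices below `d`, listed as `j` and then `i`. -/
abbrev IndexPair (d : ℕ) : Type := Σ j : Fin d, Fin j

theorem card_indexPair_mul_two (d : ℕ) : Fintype.card (IndexPair d) * 2 = d * (d - 1) := by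
  simp only [Fintype.card_sigma, Fintype.card_fin]
  rw [Fin.sum_univ_eq_sum_range (fun j => j), Finset.sum_range_id_mul_two]

/-- The point `(eᵢ, eⱼ)` of `ℝ^{2d}`. -/
def pairPoint (k : IndexPair d) : EuclideanSpace ℝ (Fin (2 * d)) :=
  (halves d).symm (WithLp.toLp 2
    (EuclideanSpace.single (Fin.castLE k.1.isLt.le k.2) 1, EuclideanSpace.single k.1 1))

theorem exists_target_pairPoint_eq (b : IndexPair d → ℤˣ) :
    ∃ g : EuclideanSpace ℝ (Fin (2 * d)) ≃ₗᵢ[ℝ] EuclideanSpace ℝ (Fin (2 * d)),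
      ∀ k, target d (g (pairPoint k)) = b k := by
  obtain ⟨Q, hQ, hsgn⟩ := exists_mem_orthogonalGroup_sgn_eq fun i j : Fin d =>
    if hij : i < j then b ⟨j, ⟨i, hij⟩⟩ else 1
  obtain ⟨U, hU⟩ := exists_linearIsometry_inner_single_eq hQ
  obtain ⟨g, hg⟩ := exists_target_halves_symm_eq U
  refine ⟨g, fun ⟨j, i⟩ => ?_⟩
  have hij : Fin.castLE j.isLt.le i < j := i.isLt
  rw [pairPoint, hg, hU, hsgn _ _ hij, dif_pos hij]
  rfl

end Rotations

/-! ### Sample size and relabelling of the domain -/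

section Suffices

variable {X Y : Type*}

/-- The algorithm on `Y` that moves its training points to `X` along `f`, runs `A`, and pulls the
resulting hypothesis back along `f`. -/
def LearningAlgorithm.comap (A : LearningAlgorithm X) (f : Y → X) : LearningAlgorithm Y :=
  fun n S => (A n fun i => Prod.map f id (S i)).map (f := fun h => h ∘ f)
    (measurable_pi_lambda _ fun y => measurable_pi_apply (f y)).aemeasurable

theorem OrthogonalEquivariant.comap_eq {m : ℕ}
    {A : LearningAlgorithm (EuclideanSpace ℝ (Fin m))} (hA : OrthogonalEquivariant A)
    (g : EuclideanSpace ℝ (Fin m) ≃ₗᵢ[ℝ] EuclideanSpace ℝ (Fin m)) : A.comap g = A :=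
  funext fun n => funext fun S => Subtype.ext (hA g n S)

variable [MeasurableSpace X] [MeasurableSpace Y]

/-- `n` samples suffice for `A` to reach error `ε` with confidence `1 - δ` on all of `Prob`. -/
def Suffices (A : LearningAlgorithm X) (Prob : Set (Measure (X × ℤˣ))) (ε δ : ℝ) (n : ℕ) : Prop :=
  ∀ P ∈ Prob, Measure.pi (fun _ : Fin n => P) {S : Dataset X n | ENNReal.ofReal ε < err P (A n S)}
    ≤ ENNReal.ofReal δ

theorem err_comap (A : LearningAlgorithm X) {f : Y → X} (hf : MeasurableEmbedding f)
    (P : Measure (Y × ℤˣ)) {n : ℕ} (S : Dataset Y n) :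
    err P (A.comap f n S) = err (P.map (Prod.map f id)) (A n fun i => Prod.map f id (S i)) := by
  rw [err, err, (hf.prodMap .id).lintegral_map]
  refine lintegral_congr fun z => ?_
  exact Measure.map_apply (measurable_pi_lambda _ fun y => measurable_pi_apply (f y))
    (measurableSet_apply_ne z.1 z.2)

theorem Suffices.comap {A : LearningAlgorithm X} {h : X → ℤˣ} {ε δ : ℝ} {n : ℕ}
    (hA : Suffices A (allDistributions h) ε δ n) (hh : Measurable h) {f : Y → X}
    (hf : MeasurableEmbedding f) : Suffices (A.comap f) (allDistributions (h ∘ f)) ε δ n := by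
  rintro P ⟨μ, hμ, rfl⟩
  have hgraph : Measurable fun y => (y, (h ∘ f) y) := measurable_id.prodMk (hh.comp hf.measurable)
  set P := μ.map fun y => (y, (h ∘ f) y)
  have hP : IsProbabilityMeasure P := Measure.isProbabilityMeasure_map hgraph.aemeasurable
  have hf' : Measurable (Prod.map f (id : ℤˣ → ℤˣ)) := hf.measurable.prodMap measurable_id
  have _ : IsProbabilityMeasure (P.map (Prod.map f id)) :=
    Measure.isProbabilityMeasure_map hf'.aemeasurable
  have hmem : P.map (Prod.map f id) ∈ allDistributions h := by
    refine ⟨μ.map f, Measure.isProbabilityMeasure_map hf.measurable.aemeasurable, ?_⟩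
    have hgraph' : Measurable fun x => (x, h x) := measurable_id.prodMk hh
    rw [Measure.map_map hf' hgraph, Measure.map_map hgraph' hf.measurable]
    rfl
  have hpi : MeasurePreserving (fun (S : Dataset Y n) i => Prod.map f id (S i))
      (Measure.pi fun _ => P) (Measure.pi fun _ => P.map (Prod.map f id)) :=
    measurePreserving_pi _ _ fun _ => ⟨hf', rfl⟩
  simp only [err_comap A hf]
  refine (Measure.le_map_apply hpi.aemeasurable
    {S | ENNReal.ofReal ε < err (P.map (Prod.map f id)) (A n S)}).trans ?_
  rw [hpi.map_eq]
  exact hA _ hmem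

end Suffices

/-! ### Learning a shattered set -/

section MistakeProb

variable {X : Type*}

/-- The probability that the random hypothesis trained on `S` does not map `x` to `y`. -/
def mistakeProb (A : LearningAlgorithm X) {n : ℕ} (S : Dataset X n) (x : X) (y : ℤˣ) : ℝ :=
  (A n S : Measure (X → ℤˣ)).real {h | h x ≠ y}

theorem mistakeProb_nonneg (A : LearningAlgorithm X) {n : ℕ} (S : Dataset X n) (x : X) (y : ℤˣ) :
    0 ≤ mistakeProb A S x y :=
  measureReal_nonneg

theorem mistakeProb_le_one (A : LearningAlgorithm X) {n : ℕ} (S : Dataset X n) (x : X) (y : ℤˣ) :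
    mistakeProb A S x y ≤ 1 :=
  measureReal_le_one

theorem mistakeProb_add_neg (A : LearningAlgorithm X) {n : ℕ} (S : Dataset X n) (x : X)
    (y : ℤˣ) : mistakeProb A S x y + mistakeProb A S x (-y) = 1 := by
  have hcompl : {h : X → ℤˣ | h x ≠ -y} = {h : X → ℤˣ | h x ≠ y}ᶜ := by
    ext h
    simp [Int.units_ne_iff_eq_neg]
  rw [mistakeProb, mistakeProb, hcompl, probReal_add_probReal_compl (measurableSet_apply_ne x y)]

theorem exists_half_le_mistakeProb (A : LearningAlgorithm X) {n : ℕ} (S : Dataset X n) (x : X) :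
    ∃ y, 1 / 2 ≤ mistakeProb A S x y := by
  by_contra! h
  linarith [mistakeProb_add_neg A S x 1, h 1, h (-1)]

variable [MeasurableSpace X] [DiscreteMeasurableSpace X] [Finite X]

theorem err_map_eq_ofReal_integral (μ : Measure X) [IsProbabilityMeasure μ] (h : X → ℤˣ)
    (A : LearningAlgorithm X) {n : ℕ} (S : Dataset X n) :
    err (μ.map fun x => (x, h x)) (A n S)
      = ENNReal.ofReal (∫ x, mistakeProb A S x (h x) ∂μ) := by
  rw [err, lintegral_map .of_discrete .of_discrete, ofReal_integral_eq_lintegral_ofReal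
    .of_finite (.of_forall fun x => mistakeProb_nonneg A S x (h x))]
  simp [mistakeProb]

theorem Suffices.measureReal_lt_integral_le {A : LearningAlgorithm X} {h : X → ℤˣ} {ε δ : ℝ} {n : ℕ}
    (hA : Suffices A (allDistributions h) ε δ n) (hε : 0 ≤ ε) (hδ : 0 ≤ δ) (μ : Measure X)
    [IsProbabilityMeasure μ] :
    (Measure.pi fun _ : Fin n => μ).real
      {J | ε < ∫ x, mistakeProb A (fun i => (J i, h (J i))) x (h x) ∂μ} ≤ δ := by
  have hgraph : Measurable fun x => (x, h x) := .of_discrete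
  have _ : IsProbabilityMeasure (μ.map fun x => (x, h x)) :=
    Measure.isProbabilityMeasure_map hgraph.aemeasurable
  have hpi : MeasurePreserving (fun (J : Fin n → X) i => (J i, h (J i)))
      (Measure.pi fun _ => μ) (Measure.pi fun _ => μ.map fun x => (x, h x)) :=
    measurePreserving_pi _ _ fun _ => ⟨hgraph, rfl⟩
  have hbad := hA _ ⟨μ, inferInstance, rfl⟩
  rw [← hpi.map_eq] at hbad
  refine ENNReal.toReal_le_of_le_ofReal hδ <|
    le_of_eq_of_le ?_ ((Measure.le_map_apply hpi.aemeasurable _).trans hbad)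
  simp only [err_map_eq_ofReal_integral, ENNReal.ofReal_lt_ofReal_iff_of_nonneg hε,
    Set.preimage_ofPred_eq]

end MistakeProb

theorem integral_le_add_mul_measureReal {Ω : Type*} [MeasurableSpace Ω] {μ : Measure Ω}
    [IsProbabilityMeasure μ] {f : Ω → ℝ} (hf : Integrable f μ) {t M : ℝ}
    (ht : MeasurableSet {ω | t < f ω}) (hM : ∀ ω, f ω ≤ M) :
    ∫ ω, f ω ∂μ ≤ t + (M - t) * μ.real {ω | t < f ω} := by
  have hind : Integrable ({ω | t < f ω}.indicator fun _ => M - t) μ :=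
    (integrable_const _).indicator ht
  calc ∫ ω, f ω ∂μ ≤ ∫ ω, t + {ω | t < f ω}.indicator (fun _ => M - t) ω ∂μ := by
        refine integral_mono hf ((integrable_const _).add hind) fun ω => ?_
        by_cases hω : t < f ω
        · simpa [hω] using hM ω
        · simp [hω, not_lt.1 hω]
    _ = t + (M - t) * μ.real {ω | t < f ω} := by
        rw [integral_add (integrable_const _) hind, integral_indicator_const _ ht]
        simp [mul_comm]

section ShatteredSet

variable {κ : Type*}

/-- The training sequence with points `J`, in which `none` has label `y` and `some k` has label
`b k`. The point `none` is an anchor that reveals nothing about the labels `b`. -/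
def starSample {n : ℕ} (y : ℤˣ) (b : κ → ℤˣ) (J : Fin n → Option κ) : Dataset (Option κ) n :=
  fun i => (J i, (J i).elim y b)

theorem starSample_update_of_unseen [DecidableEq κ] {n : ℕ} (y : ℤˣ) (b : κ → ℤˣ) (v : ℤˣ)
    {J : Fin n → Option κ} {k : κ} (hJ : ∀ i, J i ≠ some k) :
    starSample y (Function.update b k v) J = starSample y b J := by
  refine funext fun i => Prod.ext rfl ?_
  change (J i).elim y (Function.update b k v) = (J i).elim y b
  cases h : J i with
  | none => rfl
  | some l =>
    have hl : l ≠ k := fun hl => hJ i (hl ▸ h)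
    exact Function.update_of_ne hl v b

variable [Fintype κ]

theorem sum_mistakeProb_of_unseen [DecidableEq κ] (A : LearningAlgorithm (Option κ)) (y : ℤˣ)
    {n : ℕ} {J : Fin n → Option κ} {k : κ} (hJ : ∀ i, J i ≠ some k) :
    ∑ b : κ → ℤˣ, mistakeProb A (starSample y b J) (some k) (b k)
      = Fintype.card (κ → ℤˣ) / 2 := by
  have hflip : Function.Involutive fun b : κ → ℤˣ => Function.update b k (-b k) := fun b => by
    simp
  have hsum := Equiv.sum_comp hflip.toPerm fun b =>
    mistakeProb A (starSample y b J) (some k) (b k)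
  simp only [Function.Involutive.coe_toPerm, starSample_update_of_unseen _ _ _ hJ,
    Function.update_self] at hsum
  have htotal : ∑ b : κ → ℤˣ, (mistakeProb A (starSample y b J) (some k) (b k)
      + mistakeProb A (starSample y b J) (some k) (-b k)) = Fintype.card (κ → ℤˣ) := by
    simp [mistakeProb_add_neg]
  rw [Finset.sum_add_distrib, hsum] at htotal
  linarith

variable [MeasurableSpace (Option κ)]

/-- The distribution with mass `1 - α` at the anchor `none` and mass `α` spread evenly over the
other points. -/
def starMeasure (κ : Type*) [Fintype κ] [MeasurableSpace (Option κ)] (α : ℝ) :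
    Measure (Option κ) :=
  ENNReal.ofReal (1 - α) • Measure.dirac none
    + ENNReal.ofReal (α / Fintype.card κ) • ∑ k, Measure.dirac (some k)

theorem isProbabilityMeasure_starMeasure [Nonempty κ] {α : ℝ} (h0 : 0 ≤ α) (h1 : α ≤ 1) :
    IsProbabilityMeasure (starMeasure κ α) := by
  constructor
  simp only [starMeasure, Measure.add_apply, Measure.smul_apply, Measure.finsetSum_apply,
    measure_univ, smul_eq_mul, mul_one, Finset.sum_const, Finset.card_univ, nsmul_eq_mul]
  rw [← ENNReal.ofReal_natCast, ← ENNReal.ofReal_mul (by positivity), div_mul_cancel₀ _ (by simp),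
    ← ENNReal.ofReal_add (sub_nonneg.2 h1) h0, sub_add_cancel, ENNReal.ofReal_one]

variable [DiscreteMeasurableSpace (Option κ)]

theorem starMeasure_real_none {α : ℝ} (h1 : α ≤ 1) : (starMeasure κ α).real {none} = 1 - α := by
  simp [starMeasure, measureReal_def, h1]

theorem starMeasure_real_some {α : ℝ} (h0 : 0 ≤ α) (k : κ) :
    (starMeasure κ α).real {some k} = α / Fintype.card κ := by
  classical
  have : 0 ≤ α / Fintype.card κ := by positivity
  simp [starMeasure, measureReal_def, Set.indicator_apply, this]

theorem integral_starMeasure [Nonempty κ] {α : ℝ} (h0 : 0 ≤ α) (h1 : α ≤ 1) (f : Option κ → ℝ) :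
    ∫ o, f o ∂(starMeasure κ α)
      = (1 - α) * f none + α / Fintype.card κ * ∑ k, f (some k) := by
  have := isProbabilityMeasure_starMeasure (κ := κ) h0 h1
  rw [integral_fintype .of_finite, Fintype.sum_option, starMeasure_real_none h1, Finset.mul_sum]
  simp only [starMeasure_real_some h0, smul_eq_mul]

theorem mul_sum_le_integral_starMeasure [Nonempty κ] {α : ℝ} (h0 : 0 ≤ α) (h1 : α ≤ 1)
    {f : Option κ → ℝ} (hf : 0 ≤ f none) :
    α / Fintype.card κ * ∑ k, f (some k) ≤ ∫ o, f o ∂(starMeasure κ α) := by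
  rw [integral_starMeasure h0 h1]
  exact le_add_of_nonneg_left (mul_nonneg (sub_nonneg.2 h1) hf)

theorem measureReal_pi_starMeasure_unseen [Nonempty κ] {α : ℝ} (h0 : 0 ≤ α) (h1 : α ≤ 1) (n : ℕ)
    (k : κ) : (Measure.pi fun _ : Fin n => starMeasure κ α).real {J | ∀ i, J i ≠ some k}
      = (1 - α / Fintype.card κ) ^ n := by
  have := isProbabilityMeasure_starMeasure (κ := κ) h0 h1
  have hset : {J : Fin n → Option κ | ∀ i, J i ≠ some k} = Set.univ.pi fun _ => {some k}ᶜ := by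
    ext; simp
  rw [hset, measureReal_def, Measure.pi_pi, ENNReal.toReal_prod, Finset.prod_const,
    Finset.card_univ, Fintype.card_fin, ← measureReal_def, probReal_compl_eq_one_sub (.singleton _),
    starMeasure_real_some h0]

variable [Nonempty κ] {A : LearningAlgorithm (Option κ)} {y : ℤˣ} {ε δ α : ℝ} {n : ℕ}

theorem le_sum_integral_mistakeProb [DecidableEq κ] (A : LearningAlgorithm (Option κ)) (y : ℤˣ)
    (h0 : 0 ≤ α) (h1 : α ≤ 1) (n : ℕ) (k : κ) :
    (1 - α / Fintype.card κ) ^ n * (Fintype.card (κ → ℤˣ) / 2)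
      ≤ ∑ b : κ → ℤˣ, ∫ J, mistakeProb A (starSample y b J) (some k) (b k)
          ∂(Measure.pi fun _ : Fin n => starMeasure κ α) := by
  have := isProbabilityMeasure_starMeasure (κ := κ) h0 h1
  rw [← measureReal_pi_starMeasure_unseen h0 h1 n k, ← smul_eq_mul,
    ← integral_indicator_const _ .of_discrete, ← integral_finsetSum _ fun _ _ => .of_finite]
  refine integral_mono .of_finite .of_finite fun J => ?_
  by_cases hJ : J ∈ {J : Fin n → Option κ | ∀ i, J i ≠ some k}
  · rw [Set.indicator_of_mem hJ, sum_mistakeProb_of_unseen A y hJ]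
  · rw [Set.indicator_of_notMem hJ]
    exact Finset.sum_nonneg fun b _ => mistakeProb_nonneg _ _ _ _

theorem Suffices.mul_sum_integral_mistakeProb_le {b : κ → ℤˣ}
    (hA : Suffices A (allDistributions fun o => o.elim y b) ε δ n) (hε : 0 ≤ ε) (hδ : 0 ≤ δ)
    (hεα : ε ≤ α) (h1 : α ≤ 1) :
    α / Fintype.card κ * ∑ k, ∫ J, mistakeProb A (starSample y b J) (some k) (b k)
        ∂(Measure.pi fun _ : Fin n => starMeasure κ α) ≤ ε + (α - ε) * δ := by
  have h0 := hε.trans hεα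
  have := isProbabilityMeasure_starMeasure (κ := κ) h0 h1
  rw [← integral_finsetSum _ fun _ _ => .of_finite, ← integral_const_mul]
  set f : (Fin n → Option κ) → ℝ := fun J =>
    α / Fintype.card κ * ∑ k, mistakeProb A (starSample y b J) (some k) (b k) with hf
  have hfα (J) : f J ≤ α := by
    calc f J ≤ α / Fintype.card κ * ∑ _k : κ, 1 := by
          simp only [hf]; gcongr; exact mistakeProb_le_one _ _ _ _
      _ = α := by simp
  have hbad : (Measure.pi fun _ : Fin n => starMeasure κ α).real {J | ε < f J} ≤ δ := by
    refine (measureReal_mono fun J (hJ : ε < f J) => hJ.trans_le ?_).trans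
      (hA.measureReal_lt_integral_le hε hδ (starMeasure κ α))
    exact mul_sum_le_integral_starMeasure h0 h1 (f := fun o =>
      mistakeProb A (starSample y b J) o (o.elim y b)) (mistakeProb_nonneg _ _ _ _)
  calc _ ≤ ε + (α - ε) * (Measure.pi fun _ : Fin n => starMeasure κ α).real {J | ε < f J} :=
        integral_le_add_mul_measureReal .of_finite .of_discrete hfα
    _ ≤ ε + (α - ε) * δ := by gcongr

theorem mul_one_sub_pow_le_of_suffices
    (hA : ∀ b : κ → ℤˣ, Suffices A (allDistributions fun o => o.elim y b) ε δ n) (hε : 0 ≤ ε)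
    (hδ : 0 ≤ δ) (hεα : ε ≤ α) (h1 : α ≤ 1) :
    α * (1 - α / Fintype.card κ) ^ n ≤ 2 * (ε + (α - ε) * δ) := by
  classical
  set N : ℝ := (Fintype.card (κ → ℤˣ) : ℝ)
  have hN : 0 < N := by simp [N]
  have h0 := hε.trans hεα
  suffices h : N / 2 * (α * (1 - α / Fintype.card κ) ^ n) ≤ N / 2 * (2 * (ε + (α - ε) * δ)) from
    le_of_mul_le_mul_left h (by positivity)
  calc N / 2 * (α * (1 - α / Fintype.card κ) ^ n)
      = α / Fintype.card κ * ∑ _k : κ, (1 - α / Fintype.card κ) ^ n * (N / 2) := by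
        simp; field_simp
    _ ≤ α / Fintype.card κ * ∑ k : κ, ∑ b : κ → ℤˣ,
          ∫ J, mistakeProb A (starSample y b J) (some k) (b k)
            ∂(Measure.pi fun _ : Fin n => starMeasure κ α) := by
        gcongr with k
        exact le_sum_integral_mistakeProb A y h0 h1 n k
    _ = ∑ b : κ → ℤˣ, α / Fintype.card κ *
          ∑ k, ∫ J, mistakeProb A (starSample y b J) (some k) (b k)
            ∂(Measure.pi fun _ : Fin n => starMeasure κ α) := by
        rw [Finset.sum_comm, Finset.mul_sum]
    _ ≤ ∑ _b : κ → ℤˣ, (ε + (α - ε) * δ) :=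
        Finset.sum_le_sum fun b _ => (hA b).mul_sum_integral_mistakeProb_le hε hδ hεα h1
    _ = N / 2 * (2 * (ε + (α - ε) * δ)) := by simp [N]; ring

theorem card_le_of_suffices
    (hA : ∀ b : κ → ℤˣ, Suffices A (allDistributions fun o => o.elim y b) ε δ n) (hε : 0 < ε)
    (hε8 : ε ≤ 1 / 8) (hδ : 0 ≤ δ) (hδ4 : δ ≤ 1 / 4) :
    5 * (Fintype.card κ : ℝ) ≤ 128 * ε * n := by
  have hm : (1 : ℝ) ≤ Fintype.card κ := mod_cast Fintype.card_pos (α := κ)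
  set m : ℝ := (Fintype.card κ : ℝ)
  have hpow : (1 - 8 * ε / m) ^ n ≤ 11 / 16 := by
    have h := mul_one_sub_pow_le_of_suffices hA (α := 8 * ε) hε.le hδ (by linarith) (by linarith)
    have hδε : (8 * ε - ε) * δ ≤ (8 * ε - ε) * (1 / 4) := by gcongr; linarith
    refine le_of_mul_le_mul_left ?_ (by positivity : 0 < 8 * ε)
    linarith
  have hsmall : 8 * ε / m ≤ 1 := by
    rw [div_le_one (by linarith)]
    linarith
  have hbernoulli : 1 + n * -(8 * ε / m) ≤ (1 - 8 * ε / m) ^ n := by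
    simpa only [← sub_eq_add_neg] using one_add_mul_le_pow (a := -(8 * ε / m)) (by linarith) n
  have hmass : 5 / 16 ≤ 8 * ε * n / m := by
    rw [mul_div_right_comm]
    linarith
  rw [le_div_iff₀ (by linarith)] at hmass
  linarith

end ShatteredSet

section SingleSample

variable {κ : Type*} [Finite κ] [Nonempty κ] [MeasurableSpace (Option κ)]
  [DiscreteMeasurableSpace (Option κ)] {A : LearningAlgorithm (Option κ)} {y : ℤˣ} {ε δ : ℝ} {n : ℕ}

theorem one_sub_pow_le_of_suffices
    (hA : ∀ b : κ → ℤˣ, Suffices A (allDistributions fun o => o.elim y b) ε δ n) (hε : 0 ≤ ε)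
    (hδ : 0 ≤ δ) {α : ℝ} (hεα : 2 * ε < α) (h1 : α ≤ 1) : (1 - α) ^ n ≤ δ := by
  have := Fintype.ofFinite κ
  have h0 : 0 ≤ α := by linarith
  have := isProbabilityMeasure_starMeasure (κ := κ) h0 h1
  choose b hb using fun k : κ => exists_half_le_mistakeProb A (fun _ : Fin n => (none, y)) (some k)
  refine le_trans ?_ ((hA b).measureReal_lt_integral_le hε hδ (starMeasure κ α))
  have hnone : (Measure.pi fun _ : Fin n => starMeasure κ α).real {fun _ => none}
      = (1 - α) ^ n := by
    rw [← starMeasure_real_none (κ := κ) h1]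
    simp [measureReal_def, Measure.pi_singleton]
  rw [← hnone]
  refine measureReal_mono (Set.singleton_subset_iff.2 ?_)
  calc ε < α / Fintype.card κ * ∑ _k : κ, 1 / 2 := by
        simp; field_simp; linarith
    _ ≤ α / Fintype.card κ * ∑ k, mistakeProb A (fun _ : Fin n => (none, y)) (some k) (b k) := by
        gcongr with k
        exact hb k
    _ ≤ _ := mul_sum_le_integral_starMeasure h0 h1 (f := fun o =>
        mistakeProb A (fun _ : Fin n => (none, y)) o (o.elim y b)) (mistakeProb_nonneg _ _ _ _)

theorem neg_two_mul_le_log_one_sub {t : ℝ} (h0 : 0 ≤ t) (ht : t ≤ 1 / 2) :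
    -(2 * t) ≤ Real.log (1 - t) := by
  have hpos : 0 < 1 - t := by linarith
  refine le_trans ?_ (Real.one_sub_inv_le_log_of_pos hpos)
  have hinv : (1 - t)⁻¹ ≤ 1 + 2 * t := by
    rw [inv_le_iff_one_le_mul₀' hpos]
    nlinarith
  linarith

theorem log_le_of_suffices
    (hA : ∀ b : κ → ℤˣ, Suffices A (allDistributions fun o => o.elim y b) ε δ n) (hε : 0 < ε)
    (hε8 : ε ≤ 1 / 8) (hδ : 0 < δ) : Real.log (1 / δ) ≤ 8 * ε * n := by
  have hpow : (1 - 4 * ε) ^ n ≤ δ :=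
    one_sub_pow_le_of_suffices hA hε.le hδ.le (by linarith) (by linarith)
  calc Real.log (1 / δ) = -Real.log δ := by rw [one_div, Real.log_inv]
    _ ≤ -Real.log ((1 - 4 * ε) ^ n) :=
        neg_le_neg (Real.log_le_log (pow_pos (by linarith) n) hpow)
    _ = n * -Real.log (1 - 4 * ε) := by rw [Real.log_pow, mul_neg]
    _ ≤ n * (8 * ε) := by
        gcongr
        linarith [neg_two_mul_le_log_one_sub (t := 4 * ε) (by linarith) (by linarith)]
    _ = 8 * ε * n := mul_comm _ _

end SingleSample

/-! ### Lower bound for equivariant algorithms -/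

section EquivariantLowerBound

theorem injective_of_shatters {X κ : Type*} {x : Option κ → X} {y : ℤˣ}
    (hx : ∀ b : κ → ℤˣ, ∃ h : X → ℤˣ, ∀ o, h (x o) = o.elim y b) : x.Injective := by
  classical
  have hsep {o o' : Option κ} (ho : o ≠ o') : ∃ b : κ → ℤˣ, o.elim y b ≠ o'.elim y b := by
    cases o with
    | none => cases o' with
      | none => exact absurd rfl ho
      | some k => exact ⟨fun _ => -y, units_ne_neg_self y⟩
    | some k => cases o' with
      | none => exact ⟨fun _ => -y, (units_ne_neg_self y).symm⟩
      | some l =>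
        have hkl : k ≠ l := fun h => ho (congrArg some h)
        exact ⟨Function.update 1 k (-1), by simp [hkl.symm]⟩
  intro o o' hoo'
  by_contra ho
  obtain ⟨b, hb⟩ := hsep ho
  obtain ⟨h, hh⟩ := hx b
  exact hb (by rw [← hh, ← hh, hoo'])

theorem measurableEmbedding_of_injective {ι X : Type*} [Finite ι] [MeasurableSpace ι]
    [DiscreteMeasurableSpace ι] [MeasurableSpace X] [MeasurableSingletonClass X] {f : ι → X}
    (hf : f.Injective) : MeasurableEmbedding f where
  injective := hf
  measurable := .of_discrete
  measurableSet_image' s _ := (s.toFinite.image f).measurableSet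

variable {d : ℕ} {A : LearningAlgorithm (EuclideanSpace ℝ (Fin (2 * d)))} {ε δ : ℝ} {n : ℕ}

theorem target_zero : target d 0 = 1 := by
  simp [target, sgn]

theorem Suffices.comap_elim_zero (hn : Suffices A (allDistributions (target d)) ε δ n)
    (hA : OrthogonalEquivariant A) {κ : Type*} [Finite κ] [MeasurableSpace (Option κ)]
    [DiscreteMeasurableSpace (Option κ)] {x : κ → EuclideanSpace ℝ (Fin (2 * d))}
    (hx : ∀ b : κ → ℤˣ, ∃ g : EuclideanSpace ℝ (Fin (2 * d)) ≃ₗᵢ[ℝ] EuclideanSpace ℝ (Fin (2 * d)),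
      ∀ k, target d (g (x k)) = b k) (b : κ → ℤˣ) :
    Suffices (A.comap fun o : Option κ => o.elim 0 x) (allDistributions fun o => o.elim 1 b)
      ε δ n := by
  have hlabel {g : EuclideanSpace ℝ (Fin (2 * d)) ≃ₗᵢ[ℝ] EuclideanSpace ℝ (Fin (2 * d))}
      {b : κ → ℤˣ} (hg : ∀ k, target d (g (x k)) = b k) (o : Option κ) :
      target d (g (o.elim 0 x)) = o.elim 1 b := by
    cases o with
    | none => simp [target_zero]
    | some k => exact hg k
  have hinj : Function.Injective fun o : Option κ => o.elim 0 x :=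
    injective_of_shatters fun b => (hx b).elim fun g hg => ⟨target d ∘ g, hlabel hg⟩
  obtain ⟨g, hg⟩ := hx b
  have hrotated : Suffices A (allDistributions (target d ∘ g)) ε δ n := by
    rw [← hA.comap_eq g]
    exact hn.comap measurable_target g.toHomeomorph.measurableEmbedding
  have hcomp : (target d ∘ g) ∘ (fun o : Option κ => o.elim 0 x) = fun o => o.elim 1 b :=
    funext (hlabel hg)
  rw [← hcomp]
  exact hrotated.comap (measurable_target.comp g.continuous.measurable)
    (measurableEmbedding_of_injective hinj)

theorem log_le_of_suffices_target (hn : Suffices A (allDistributions (target d)) ε δ n)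
    (hA : OrthogonalEquivariant A) (hd : 1 ≤ d) (hε : 0 < ε) (hε8 : ε ≤ 1 / 8) (hδ : 0 < δ) :
    Real.log (1 / δ) ≤ 8 * ε * n := by
  let _ : MeasurableSpace (Option Unit) := ⊤
  have : DiscreteMeasurableSpace (Option Unit) := ⟨fun _ => trivial⟩
  obtain ⟨x, hx⟩ := exists_target_eq_of_unit hd
  exact log_le_of_suffices (hn.comap_elim_zero hA (x := fun _ : Unit => x) fun b =>
    (hx (b ())).imp fun _ hg _ => hg) hε hε8 hδ

theorem sq_le_of_suffices_target (hn : Suffices A (allDistributions (target d)) ε δ n)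
    (hA : OrthogonalEquivariant A) (hd : 2 ≤ d) (hε : 0 < ε) (hε8 : ε ≤ 1 / 8) (hδ : 0 ≤ δ)
    (hδ4 : δ ≤ 1 / 4) : (d : ℝ) ^ 2 ≤ 104 * (ε * n) := by
  let _ : MeasurableSpace (Option (IndexPair d)) := ⊤
  have : DiscreteMeasurableSpace (Option (IndexPair d)) := ⟨fun _ => trivial⟩
  have : Nonempty (IndexPair d) := ⟨⟨⟨1, hd⟩, ⟨0, one_pos⟩⟩⟩
  have hcard := card_le_of_suffices (hn.comap_elim_zero hA exists_target_pairPoint_eq) hε hε8 hδ hδ4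
  have hpairs : (Fintype.card (IndexPair d) : ℝ) * 2 = d * (d - 1) := by
    rw [← Nat.cast_pred (by lia)]
    exact_mod_cast card_indexPair_mul_two d
  have hd' : (2 : ℝ) ≤ d := mod_cast hd
  nlinarith

theorem le_of_suffices_target (hn : Suffices A (allDistributions (target d)) ε δ n)
    (hA : OrthogonalEquivariant A) (hd : 1 ≤ d) (hε : 0 < ε) (hε8 : ε ≤ 1 / 8) (hδ : 0 < δ)
    (hδ4 : δ ≤ 1 / 4) : 1 / 120 * (((d : ℝ) ^ 2 + Real.log (1 / δ)) / ε) ≤ n := by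
  have hlog := log_le_of_suffices_target hn hA hd hε hε8 hδ
  have hlog1 : 1 ≤ Real.log (1 / δ) := by
    rw [Real.le_log_iff_exp_le (by positivity)]
    calc Real.exp 1 ≤ 4 := by linarith [Real.exp_one_lt_d9]
      _ ≤ 1 / δ := by rw [le_div_iff₀ hδ]; linarith
  have hsq : (d : ℝ) ^ 2 ≤ 104 * (ε * n) := by
    rcases hd.eq_or_lt with rfl | hd
    · rw [Nat.cast_one, one_pow]
      linarith
    · exact sq_le_of_suffices_target hn hA hd hε hε8 hδ.le hδ4
  rw [← mul_div_assoc, div_le_iff₀ hε]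
  linarith

theorem le_sampleComplexity (hA : OrthogonalEquivariant A) (hd : 1 ≤ d) (hε : 0 < ε)
    (hε8 : ε ≤ 1 / 8) (hδ : 0 < δ) (hδ4 : δ ≤ 1 / 4) :
    ENNReal.ofReal (1 / 120 * (((d : ℝ) ^ 2 + Real.log (1 / δ)) / ε)) ≤
      ((sampleComplexity A (allDistributions (target d)) ε δ : ℕ∞) : ℝ≥0∞) := by
  rcases Set.eq_empty_or_nonempty {n | Suffices A (allDistributions (target d)) ε δ n} with
    hnone | hsome
  · have htop : sampleComplexity A (allDistributions (target d)) ε δ = ⊤ := by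
      change sInf ((fun n : ℕ => (n : ℕ∞)) ''
        {n | Suffices A (allDistributions (target d)) ε δ n}) = ⊤
      rw [hnone, Set.image_empty, sInf_empty]
    simp [htop]
  · obtain ⟨n, hn, heq : n = sampleComplexity A (allDistributions (target d)) ε δ⟩ :=
      csInf_mem (hsome.image fun n : ℕ => (n : ℕ∞))
    rw [← heq, ENat.toENNReal_coe, ← ENNReal.ofReal_natCast]
    exact ENNReal.ofReal_le_ofReal (le_of_suffices_target hn hA hd hε hε8 hδ hδ4)

end EquivariantLowerBound

end ConvSep

end

theorem theorem3p1 :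
    -- lower bound for every orthogonal equivariant algorithm
    (∃ c : ℝ, 0 < c ∧ ∀ d : ℕ, 1 ≤ d →
      ∀ A : ConvSep.LearningAlgorithm (EuclideanSpace ℝ (Fin (2 * d))),
        ConvSep.OrthogonalEquivariant A →
        ∀ ε δ : ℝ, 0 < ε → ε ≤ 1 / 8 → 0 < δ → δ ≤ 1 / 4 →
          ENNReal.ofReal (c * (((d : ℝ) ^ 2 + Real.log (1 / δ)) / ε)) ≤
            ((ConvSep.sampleComplexity A
              (ConvSep.allDistributions (ConvSep.target d)) ε δ : ℕ∞) : ℝ≥0∞)) ∧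
    -- upper bound for every empirical risk minimizer over the 2-layer CNN with one filter of
    -- width 1, square activation and sum pooling over the two halves of the input
    (∃ C : ℝ, 0 < C ∧ ∀ d : ℕ, 1 ≤ d →
      ∀ A : (n : ℕ) → ConvSep.Dataset (EuclideanSpace ℝ (Fin (2 * d))) n →
          (EuclideanSpace ℝ (Fin (2 * d)) → ℤˣ),
        ConvSep.IsERM (ConvSep.cnnClass 1 2 d ConvSep.squarePool) A →
        ∀ ε δ : ℝ, 0 < ε → ε ≤ 1 / 2 → 0 < δ → δ < 1 →
          ((ConvSep.sampleComplexity (ConvSep.deterministic A)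
              (ConvSep.allDistributions (ConvSep.target d)) ε δ : ℕ∞) : ℝ≥0∞) ≤
            ENNReal.ofReal (C * (1 / ε * (Real.log (1 / ε) + Real.log (1 / δ))))) ∧
    -- gradient descent on the same CNN from Gaussian initialization finds an empirical risk
    -- minimizer, of training error zero, on all training data labelled by the target
    (∀ d : ℕ, 1 ≤ d → ∀ ℓ : ℝ → ℝ, ConvSep.IsSurrogateLoss ℓ →
      ∀ᵐ W₀ ∂(ConvSep.gaussianInit 1 2),
        ∀ (n : ℕ) (S : ConvSep.Dataset (EuclideanSpace ℝ (Fin (2 * d))) n),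
          (∀ i, (S i).2 = ConvSep.target d (S i).1) →
          ∃ η₀ : ℝ, 0 < η₀ ∧ ∀ η : ℝ, 0 < η → η < η₀ →
            Tendsto (fun T : ℕ => ConvSep.trainLoss ℓ ConvSep.squarePool S
                ((ConvSep.gdStep ℓ ConvSep.squarePool S η)^[T] W₀)) atTop (𝓝 0) ∧
            ∀ᶠ T : ℕ in atTop,
              (∀ i, ConvSep.sgn (ConvSep.cnn ConvSep.squarePool
                ((ConvSep.gdStep ℓ ConvSep.squarePool S η)^[T] W₀) (S i).1) = (S i).2) ∧
              ConvSep.IsEmpiricalRiskMinimizer (ConvSep.cnnClass 1 2 d ConvSep.squarePool) S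
                (fun x => ConvSep.sgn (ConvSep.cnn ConvSep.squarePool
                  ((ConvSep.gdStep ℓ ConvSep.squarePool S η)^[T] W₀) x))) :=
  ⟨⟨1 / 120, by norm_num, fun d hd A hA ε δ hε hε8 hδ hδ4 =>
      ConvSep.le_sampleComplexity hA hd hε hε8 hδ hδ4⟩,
    ⟨130, by norm_num, fun d _ A hA ε δ hε hε2 hδ hδ1 =>
      ConvSep.sampleComplexity_cnn_le hA hε hε2 hδ hδ1⟩,
    fun d _ ℓ hℓ => (ConvSep.ae_gaussianInit_fst_ne_zero 1 2 0).mono fun W₀ hW₀ n S hS =>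
      ConvSep.exists_forall_gdStep_isEmpiricalRiskMinimizer hℓ S
        ⟨(![1, -1], 0), fun i => (hS i).trans (ConvSep.target_eq_sgn_cnn hW₀ _)⟩⟩
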